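/- For $\rho\in\{-1,1,*\}^n$ let $Q_\rho$ be the subcube of all $x\in\{-1,1\}^n$ with $x_i=\rho_i$ whenever $\rho_i\ne *$. A subcube conditioning query $\rho$ to a probability distribution $p$ on $\{-1,1\}^n$ returns a sample of $p$ conditioned on $Q_\rho$ (a uniformly random point of $Q_\rho$ if $p(Q_\rho)=0$). The distribution $p$ is a $k$-junta distribution if its probability mass function depends on at most $k$ of the $n$ variables, and $p$ is $\varepsilon$-far from every $k$-junta distribution if $d_{\mathrm{TV}}(p,q)\ge\varepsilon$ for every $k$-junta distribution $q$ on $\{-1,1\}^n$. Theorem (Lower bound for junta testing). There exist absolute constants $\varepsilon_0>0$, $C_0\in\mathbb N$, $c>0$ and $d\in\mathbb N$ such that the following holds for all $0<\varepsilon\le\varepsilon_0$ and all integers $n\ge C_0$ and $0\le k\le n/2$. Let $A$ be a randomized adaptive algorithm which makes at most $q$ subcube conditioning queries to an unknown distribution $p$ on $\{-1,1\}^n$, accepts with probability at least $2/3$ if $p$ is a $k$-junta distribution, and rejects with probability at least $2/3$ if $p$ is $\varepsilon$-far from every $k$-junta distribution. Then $$q\;\ge\;\frac{c}{\varepsilon^2}\cdot\frac{k+\sqrt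 n}{1+|\log(k+\sqrt n)|^{d}},$$ that is, $A$ needs $\tilde\Omega(k+\sqrt n)/\varepsilon^2$ queries. Furthermore, the same lower bound holds if $A$ is only required to satisfy these guarantees for product distributions $p$. -/

import Mathlib

namespace JuntaTesting

/-- The cube of dimension `n`. Each of the two signs `-1`, `1` is encoded by a Boolean. -/
abbrev Cube (n : ℕ) : Type := Fin n → Bool

/-- A restriction, that is, a string over the two signs and a star; `none` is the star. -/
abbrev Restriction (n : ℕ) : Type := Fin n → Option Bool

/-- The subcube of all points that agree with every non-star entry of `ρ`. -/
def subcube {n : ℕ} (ρ : Restriction n) : Finset (Cube n) :=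
  Finset.univ.filter fun x => ∀ i, ρ i = none ∨ ρ i = some (x i)

theorem subcube_nonempty {n : ℕ} (ρ : Restriction n) : (subcube ρ).Nonempty := by
  refine ⟨fun i => (ρ i).getD false, ?_⟩
  simp only [subcube, Finset.mem_filter, Finset.mem_univ, true_and]
  intro i
  cases h : ρ i <;> simp

open Classical in
/-- The distribution of the oracle's answer to the query `ρ`: a sample of `p` conditioned on lying
in the subcube of `ρ`, and a uniform point of the subcube if `p` gives it probability zero. -/
noncomputable def oracle {n : ℕ} (p : PMF (Cube n)) (ρ : Restriction n) : PMF (Cube n) :=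
  if h : ∃ x ∈ (subcube ρ : Set (Cube n)), x ∈ p.support then
    p.filter (subcube ρ : Set (Cube n)) h
  else PMF.uniformOfFinset (subcube ρ) (subcube_nonempty ρ)

/-- A deterministic adaptive algorithm with access to the oracle: it either stops with a verdict
(`true` is accept, `false` is reject), or it makes a query and goes on depending on the answer. -/
inductive DetAlg (n : ℕ) : Type
  | output (verdict : Bool) : DetAlg n
  | query (ρ : Restriction n) (next : Cube n → DetAlg n) : DetAlg n

/-- The largest number of queries made on any run; only answers in the queried subcube count. -/
def DetAlg.queries {n : ℕ} : DetAlg n → ℕ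
  | .output _ => 0
  | .query ρ next => 1 + (subcube ρ).sup fun x => (next x).queries

/-- The distribution of the verdict when the unknown distribution is `p`. -/
noncomputable def DetAlg.run {n : ℕ} (p : PMF (Cube n)) : DetAlg n → PMF Bool
  | .output b => PMF.pure b
  | .query ρ next => (oracle p ρ).bind fun x => (next x).run p

/-- A randomized algorithm is a probability distribution over deterministic ones (of which there
are countably many, since there are finitely many queries and answers). -/
abbrev RandAlg (n : ℕ) : Type := PMF (DetAlg n)

/-- The distribution of the verdict, over the coins of the algorithm and the oracle's answers. -/
noncomputable def RandAlg.run {n : ℕ} (A : RandAlg n) (p : PMF (Cube n)) : PMF Bool :=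
  A.bind fun T => T.run p

/-- The algorithm never makes more than `q` queries. -/
def RandAlg.MakesAtMost {n : ℕ} (A : RandAlg n) (q : ℕ) : Prop :=
  ∀ T ∈ A.support, T.queries ≤ q

/-- `p` is a `k`-junta distribution: its probability mass function depends on at most `k`
variables. -/
def IsJunta {n : ℕ} (k : ℕ) (p : PMF (Cube n)) : Prop :=
  ∃ J : Finset (Fin n), J.card ≤ k ∧ DependsOn (fun x : Cube n => p x) (J : Set (Fin n))

/-- Total variation distance. -/
noncomputable def dTV {n : ℕ} (p q : PMF (Cube n)) : ℝ :=
  (∑ x, |(p x).toReal - (q x).toReal|) / 2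

/-- `p` is `ε`-far from every `k`-junta distribution. -/
def IsFarFromJunta {n : ℕ} (k : ℕ) (ε : ℝ) (p : PMF (Cube n)) : Prop :=
  ∀ q : PMF (Cube n), IsJunta k q → ε ≤ dTV p q

/-- `p` is a product distribution: its coordinates are independent. -/
def IsProduct {n : ℕ} (p : PMF (Cube n)) : Prop :=
  ∃ f : Fin n → PMF Bool, ∀ x, p x = ∏ i, f i (x i)

/-- `A` distinguishes, with probability at least `2/3`, the `k`-junta distributions from those
that are `ε`-far from every `k`-junta distribution, for unknown distributions promised to lie in
the class `P`. -/
def IsJuntaTester {n : ℕ} (P : Set (PMF (Cube n))) (k : ℕ) (ε : ℝ) (A : RandAlg n) : Prop :=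
  ∀ p ∈ P, (IsJunta k p → 2 / 3 ≤ A.run p true) ∧ (IsFarFromJunta k ε p → 2 / 3 ≤ A.run p false)

end JuntaTesting

/-!
A query to a product distribution of full support is answered by one independent sample with some
coordinates overwritten, so it suffices to consider algorithms that see `q` independent samples.
Let the tester face a product distribution whose biases are drawn independently from one of two
priors with the same moments of order less than `2 * L`. In a single coordinate, the mixtures of
`q` samples under the two priors are then close in chi-squared divergence, which tensorizes over
the coordinates, so the tester cannot tell the priors apart.

The priors are the centered binomial distribution on `-L, …, L` conditioned on being even or odd,
scaled by a factor `δ`; their moments agree because a `2 * L`-th finite difference annihilates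
polynomials of lower degree. An even bias often vanishes, so few coordinates are relevant. An odd
bias never does, and a fourth moment bound on a product of many small biases shows that ignoring
these coordinates costs total variation distance. Taking `L = 1` yields the term `√n`, and `L` of
order `log k` yields the term `k`.
-/

namespace JuntaTesting

open Finset
open scoped BigOperators

section ProductPMF

variable {ι κ κ' τ : Type*} [Fintype ι] [DecidableEq ι] [Fintype κ]

/-- The joint distribution of independent random variables with distributions `f i`. -/
noncomputable def productPMF (f : ι → PMF κ) : PMF (ι → κ) :=
  PMF.ofFintype (fun x => ∏ i, f i (x i)) <| by
    rw [← Fintype.piFinset_univ, ← prod_univ_sum]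
    exact prod_eq_one fun i _ => by rw [← tsum_fintype (L := .unconditional _), (f i).tsum_coe]

theorem productPMF_apply (f : ι → PMF κ) (x : ι → κ) : productPMF f x = ∏ i, f i (x i) := rfl

theorem isProduct_productPMF {n : ℕ} (f : Fin n → PMF Bool) : IsProduct (productPMF f) :=
  ⟨f, fun _ => rfl⟩

theorem productPMF_ne_zero {f : ι → PMF κ} (hf : ∀ i b, f i b ≠ 0) (x : ι → κ) :
    productPMF f x ≠ 0 :=
  prod_ne_zero_iff.2 fun i _ => hf i (x i)

theorem productPMF_pure (a : ι → κ) : productPMF (fun i => PMF.pure (a i)) = PMF.pure a := by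
  classical
  ext x
  simp only [productPMF_apply, PMF.pure_apply, prod_ite_zero, prod_const_one, mem_univ,
    true_imp_iff, funext_iff]

theorem productPMF_bind [Fintype κ'] (f : ι → PMF κ) (K : ι → κ → PMF κ') :
    ((productPMF f).bind fun a => productPMF fun i => K i (a i))
      = productPMF fun i => (f i).bind (K i) := by
  ext x
  simp only [PMF.bind_apply, productPMF_apply, tsum_fintype, ← prod_mul_distrib, prod_univ_sum,
    Fintype.piFinset_univ]

theorem productPMF_map [Fintype κ'] (f : ι → PMF κ) (g : ι → κ → κ') :
    (productPMF f).map (fun x i => g i (x i)) = productPMF fun i => (f i).map (g i) := by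
  simp only [← PMF.bind_pure_comp, ← productPMF_bind, Function.comp_def, productPMF_pure]

theorem productPMF_comm [Fintype τ] [DecidableEq τ] (f : τ → ι → PMF κ) :
    (productPMF fun t => productPMF (f t))
      = (productPMF fun i => productPMF fun t => f t i).map Function.swap := by
  classical
  ext y
  rw [PMF.map_apply, tsum_eq_single (Function.swap y), if_pos rfl]
  · exact prod_comm
  · intro x hx
    exact if_neg fun h => hx (by rw [h])

theorem productPMF_fin_succ {q : ℕ} (f : Fin (q + 1) → PMF κ) :
    productPMF f = (f 0).bind fun x => (productPMF (Fin.tail f)).map (Fin.cons x) := by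
  classical
  ext y
  have hcons : ∀ x z, y = Fin.cons x z → x = y 0 ∧ z = Fin.tail y := by
    rintro x z rfl
    exact ⟨rfl, rfl⟩
  rw [PMF.bind_apply, tsum_eq_single (y 0), PMF.map_apply, tsum_eq_single (Fin.tail y),
    if_pos (Fin.cons_self_tail y).symm]
  · exact Fin.prod_univ_succ _
  · exact fun z hz => if_neg fun h => hz (hcons _ z h).2
  · intro x hx
    rw [PMF.map_apply]
    refine mul_eq_zero_of_right _ (ENNReal.tsum_eq_zero.2 fun z => ?_)
    exact if_neg fun h => hx (hcons x z h).1

end ProductPMF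

section Simulation

variable {n : ℕ}

/-- The point of the subcube of `ρ` obtained from `x` by overwriting the fixed coordinates; it
turns a sample of a product distribution into an answer of the oracle. -/
def overwrite (ρ : Restriction n) (x : Cube n) : Cube n := fun i => (ρ i).getD (x i)

theorem mem_subcube {ρ : Restriction n} {x : Cube n} :
    x ∈ subcube ρ ↔ ∀ i, ρ i = none ∨ ρ i = some (x i) := by
  simp only [subcube, mem_filter, mem_univ, true_and]

theorem overwrite_mem_subcube (ρ : Restriction n) (x : Cube n) : overwrite ρ x ∈ subcube ρ :=
  mem_subcube.2 fun i => by cases h : ρ i <;> simp [overwrite, h]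

theorem indicator_subcube_productPMF (f : Fin n → PMF Bool) (ρ : Restriction n) (x : Cube n) :
    (subcube ρ : Set (Cube n)).indicator (productPMF f) x
      = (∏ i, (ρ i).elim 1 (f i)) * productPMF (fun i => (ρ i).elim (f i) PMF.pure) x := by
  classical
  have hcoord : ∀ i, (if ρ i = none ∨ ρ i = some (x i) then f i (x i) else 0)
      = (ρ i).elim 1 (f i) * (ρ i).elim (f i) PMF.pure (x i) := fun i => by
    rcases ρ i with _ | b
    · simp
    · rcases eq_or_ne b (x i) with rfl | h <;> simp [PMF.pure_apply, *, Ne.symm]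
  simp only [Set.indicator_apply, mem_coe, mem_subcube, productPMF_apply, ← prod_mul_distrib,
    ← hcoord, prod_ite_zero, mem_univ, true_imp_iff]

theorem oracle_productPMF {f : Fin n → PMF Bool} (hf : ∀ i b, f i b ≠ 0) (ρ : Restriction n) :
    oracle (productPMF f) ρ = productPMF fun i => (ρ i).elim (f i) PMF.pure := by
  have hmeets : ∃ x ∈ (subcube ρ : Set (Cube n)), x ∈ (productPMF f).support :=
    (subcube_nonempty ρ).imp fun x hx => ⟨hx, productPMF_ne_zero hf x⟩
  have hmass : (∏ i, (ρ i).elim 1 (f i)) ≠ 0 :=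
    prod_ne_zero_iff.2 fun i _ => by cases ρ i <;> simp [hf]
  have hmass' : (∏ i, (ρ i).elim 1 (f i)) ≠ ⊤ :=
    ENNReal.prod_ne_top fun i _ => by cases ρ i <;> simp [PMF.apply_ne_top]
  rw [oracle, dif_pos hmeets]
  ext x
  rw [PMF.filter_apply, tsum_congr (indicator_subcube_productPMF f ρ), ENNReal.tsum_mul_left,
    PMF.tsum_coe, mul_one, indicator_subcube_productPMF, mul_right_comm,
    ENNReal.mul_inv_cancel hmass hmass', one_mul]

theorem oracle_productPMF_eq_map_overwrite {f : Fin n → PMF Bool} (hf : ∀ i b, f i b ≠ 0)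
    (ρ : Restriction n) : oracle (productPMF f) ρ = (productPMF f).map (overwrite ρ) := by
  rw [oracle_productPMF hf]
  refine .trans (congrArg productPMF (funext fun i => ?_))
    (productPMF_map f fun i => (ρ i).getD).symm
  rcases ρ i with _ | b
  · exact (PMF.map_id _).symm
  · exact (PMF.map_const _ b).symm

theorem DetAlg.exists_run_productPMF_eq_map (q : ℕ) (T : DetAlg n) (hT : T.queries ≤ q) :
    ∃ G : (Fin q → Cube n) → Bool, ∀ f : Fin n → PMF Bool, (∀ i b, f i b ≠ 0) →
      T.run (productPMF f) = (productPMF fun _ => productPMF f).map G := by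
  induction q generalizing T with
  | zero =>
    rcases T with v | ⟨ρ, next⟩
    · exact ⟨Function.const _ v, fun f _ => (PMF.map_const _ v).symm⟩
    · simp [DetAlg.queries] at hT
  | succ q ih =>
    rcases T with v | ⟨ρ, next⟩
    · exact ⟨Function.const _ v, fun f _ => (PMF.map_const _ v).symm⟩
    · have hnext (x : Cube n) : (next (overwrite ρ x)).queries ≤ q := by
        have hle := le_sup (f := fun x => (next x).queries) (overwrite_mem_subcube ρ x)
        simp only [DetAlg.queries] at hT
        omega
      choose G hG using fun x => ih _ (hnext x)
      refine ⟨fun y => G (y 0) (Fin.tail y), fun f hf => ?_⟩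
      rw [DetAlg.run, oracle_productPMF_eq_map_overwrite hf, PMF.bind_map, productPMF_fin_succ,
        PMF.map_bind]
      congr 1
      ext1 x
      rw [PMF.map_comp]
      exact hG x f hf

end Simulation

section BiasedSigns

variable {ι : Type*} [Fintype ι] [DecidableEq ι]

/-- The sign encoded by a Boolean, as a real number. -/
def sgn (b : Bool) : ℝ := if b then 1 else -1

@[simp] theorem sgn_true : sgn true = 1 := rfl

@[simp] theorem sgn_false : sgn false = -1 := rfl

theorem one_add_mul_sgn_pos (μ : Set.Ioo (-1 : ℝ) 1) (b : Bool) : 0 < 1 + μ * sgn b := by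
  obtain ⟨μ, hlt, hgt⟩ := μ
  cases b <;> simp <;> linarith

/-- The distribution on the two signs with mean `μ`. -/
noncomputable def signPMF (μ : Set.Ioo (-1 : ℝ) 1) : PMF Bool :=
  PMF.ofFintype (fun b => ENNReal.ofReal ((1 + μ * sgn b) / 2)) <| by
    rw [Fintype.sum_bool, ← ENNReal.ofReal_add (half_pos (one_add_mul_sgn_pos μ _)).le
      (half_pos (one_add_mul_sgn_pos μ _)).le, ENNReal.ofReal_eq_one]
    simp only [sgn_true, sgn_false]
    ring

theorem signPMF_apply (μ : Set.Ioo (-1 : ℝ) 1) (b : Bool) :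
    signPMF μ b = ENNReal.ofReal ((1 + μ * sgn b) / 2) := rfl

theorem signPMF_toReal (μ : Set.Ioo (-1 : ℝ) 1) (b : Bool) :
    (signPMF μ b).toReal = (1 + μ * sgn b) / 2 :=
  ENNReal.toReal_ofReal (half_pos (one_add_mul_sgn_pos μ b)).le

theorem signPMF_ne_zero (μ : Set.Ioo (-1 : ℝ) 1) (b : Bool) : signPMF μ b ≠ 0 :=
  (ENNReal.ofReal_pos.2 (half_pos (one_add_mul_sgn_pos μ b))).ne'

/-- The product distribution on the signs with means `μ i`. -/
noncomputable def biasedPMF (μ : ι → Set.Ioo (-1 : ℝ) 1) : PMF (ι → Bool) :=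
  productPMF fun i => signPMF (μ i)

theorem biasedPMF_toReal (μ : ι → Set.Ioo (-1 : ℝ) 1) (x : ι → Bool) :
    (biasedPMF μ x).toReal = ∏ i, (1 + μ i * sgn (x i)) / 2 := by
  simp only [biasedPMF, productPMF_apply, ENNReal.toReal_prod, signPMF_toReal]

theorem isJunta_biasedPMF {n k : ℕ} {μ : Fin n → Set.Ioo (-1 : ℝ) 1}
    (hμ : #{i | (μ i : ℝ) ≠ 0} ≤ k) : IsJunta k (biasedPMF μ) := by
  refine ⟨_, hμ, fun x y hxy => ?_⟩
  simp only [biasedPMF, productPMF_apply]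
  refine prod_congr rfl fun i _ => ?_
  by_cases hi : (μ i : ℝ) = 0
  · simp only [signPMF_apply, hi, zero_mul]
  · rw [hxy i (by simpa using hi)]

end BiasedSigns

section ProductExpectations

variable {ι κ : Type*} [Fintype ι] [DecidableEq ι] [Fintype κ]

theorem expect_sum_piecewise [Nonempty κ] (T : Finset ι) (F : (ι → κ) → ℝ) :
    𝔼 x, ∑ y, F (T.piecewise x y) = ∑ x, F x := by
  have hswap : Function.Involutive fun z : (ι → κ) × (ι → κ) =>
      (T.piecewise z.1 z.2, T.piecewise z.2 z.1) := by
    rintro ⟨x, y⟩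
    ext i <;> by_cases hi : i ∈ T <;> simp [hi]
  rw [Fintype.expect_eq_sum_div_card, div_eq_iff (by positivity)]
  calc ∑ x, ∑ y, F (T.piecewise x y)
      = ∑ z : (ι → κ) × (ι → κ), F (T.piecewise z.1 z.2) := by rw [Fintype.sum_prod_type]
    _ = ∑ z : (ι → κ) × (ι → κ), F z.1 := hswap.bijective.sum_comp fun z => F z.1
    _ = (∑ x, F x) * Fintype.card (ι → κ) := by simp [Fintype.sum_prod_type_right, mul_comm]

theorem expect_prod_comp_apply [Nonempty κ] (T : Finset ι) (g : ι → κ → ℝ) :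
    𝔼 x : ι → κ, ∏ i ∈ T, g i (x i) = ∏ i ∈ T, 𝔼 b, g i b := by
  have hcard : (Fintype.card (ι → κ) : ℝ) = ∏ _i : ι, (Fintype.card κ : ℝ) := by simp
  simp_rw [← prod_ite_mem_eq T]
  rw [Fintype.expect_eq_sum_div_card, ← Fintype.piFinset_univ,
    ← prod_univ_sum (f := fun i b => if i ∈ T then g i b else 1), hcard, ← prod_div_distrib]
  refine prod_congr rfl fun i _ => ?_
  rw [← Fintype.expect_eq_sum_div_card]
  split_ifs
  · rfl
  · exact Fintype.expect_const 1

theorem expect_prod_one_add_mul_sgn_pow (T : Finset ι) (μ : ι → ℝ) (m : ℕ) :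
    𝔼 x : ι → Bool, (∏ i ∈ T, (1 + μ i * sgn (x i))) ^ m
      = ∏ i ∈ T, ((1 + μ i) ^ m + (1 - μ i) ^ m) / 2 := by
  simp_rw [← prod_pow, expect_prod_comp_apply T fun i b => (1 + μ i * sgn b) ^ m,
    Fintype.expect_eq_sum_div_card, Fintype.sum_bool]
  simp [sub_eq_add_neg]

end ProductExpectations

section FourthMoment

theorem one_add_sum_le_prod_one_add {ι R : Type*} [CommSemiring R] [PartialOrder R]
    [IsOrderedRing R] (T : Finset ι) {f : ι → R} (hf : ∀ i ∈ T, 0 ≤ f i) :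
    1 + ∑ i ∈ T, f i ≤ ∏ i ∈ T, (1 + f i) := by
  classical
  induction T using Finset.induction_on with
  | empty => simp
  | insert a s ha ih =>
    have hs : ∀ i ∈ s, 0 ≤ f i := fun i hi => hf i (mem_insert_of_mem hi)
    have ha0 : 0 ≤ f a := hf a (mem_insert_self a s)
    rw [sum_insert ha, prod_insert ha]
    calc 1 + (f a + ∑ i ∈ s, f i)
        ≤ 1 + (f a + ∑ i ∈ s, f i) + f a * ∑ i ∈ s, f i :=
          le_add_of_nonneg_right (mul_nonneg ha0 (sum_nonneg hs))
      _ = (1 + f a) * (1 + ∑ i ∈ s, f i) := by ring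
      _ ≤ (1 + f a) * ∏ i ∈ s, (1 + f i) :=
          mul_le_mul_of_nonneg_left (ih hs) (add_nonneg zero_le_one ha0)

theorem exp_le_one_add_add_sq {x : ℝ} (h0 : 0 ≤ x) (h1 : x ≤ 1) :
    Real.exp x ≤ 1 + x + x ^ 2 := by
  linarith [(abs_le.1 (Real.abs_exp_sub_one_sub_id_le (abs_le.2 ⟨by linarith, h1⟩))).2]

theorem sq_div_sub_pow_four_div_le_abs {t : ℝ} (ht : 0 < t) (v : ℝ) :
    v ^ 2 / t - v ^ 4 / t ^ 3 ≤ |v| := by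
  have hunit : ∀ u : ℝ, 0 ≤ u → u ^ 2 - u ^ 4 ≤ u := by
    intro u hu
    have hcubic : 0 ≤ 1 - u + u ^ 3 := by
      rcases le_total u 1 with h | h
      · nlinarith [pow_nonneg hu 3]
      · nlinarith [mul_nonneg hu (sub_nonneg.2 h), mul_nonneg (mul_nonneg hu (sub_nonneg.2 h)) hu]
    nlinarith [mul_nonneg hu hcubic]
  calc v ^ 2 / t - v ^ 4 / t ^ 3
      = ((|v| / t) ^ 2 - (|v| / t) ^ 4) * t := by
        rw [div_pow, div_pow, sq_abs, Even.pow_abs ⟨2, rfl⟩]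
        field_simp
        ring
    _ ≤ |v| / t * t := mul_le_mul_of_nonneg_right (hunit _ (by positivity)) ht.le
    _ = |v| := div_mul_cancel₀ _ ht.ne'

theorem div_twenty_le_expect_abs {Ω : Type*} [Fintype Ω] {X : Ω → ℝ} {t : ℝ} (ht : 0 < t)
    (hsq : t ^ 2 ≤ 𝔼 x, X x ^ 2) (hfour : 𝔼 x, X x ^ 4 ≤ 45 * t ^ 4) :
    t / 20 ≤ 𝔼 x, |X x| := by
  calc t / 20
      ≤ t ^ 2 / (12 * t) - 45 * t ^ 4 / (12 * t) ^ 3 := by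
        field_simp
        norm_num
    _ ≤ (𝔼 x, X x ^ 2) / (12 * t) - (𝔼 x, X x ^ 4) / (12 * t) ^ 3 := by gcongr
    _ = 𝔼 x, (X x ^ 2 / (12 * t) - X x ^ 4 / (12 * t) ^ 3) := by
        rw [expect_sub_distrib, expect_div, expect_div]
    _ ≤ 𝔼 x, |X x| := expect_le_expect fun x _ =>
        sq_div_sub_pow_four_div_le_abs (by positivity) (X x)

variable {ι : Type*} [Fintype ι] [DecidableEq ι] (T : Finset ι) (μ : ι → ℝ)

theorem expect_prod_one_add_mul_sgn_sub_one_sq :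
    𝔼 x : ι → Bool, (∏ i ∈ T, (1 + μ i * sgn (x i)) - 1) ^ 2 = ∏ i ∈ T, (1 + μ i ^ 2) - 1 := by
  have hexpand : ∀ P : ℝ, (P - 1) ^ 2 = P ^ 2 - 2 * P ^ 1 + 1 := fun P => by ring
  have h₁ : ∀ u : ℝ, ((1 + u) ^ 1 + (1 - u) ^ 1) / 2 = 1 := fun u => by ring
  have h₂ : ∀ u : ℝ, ((1 + u) ^ 2 + (1 - u) ^ 2) / 2 = 1 + u ^ 2 := fun u => by ring
  simp_rw [hexpand, expect_add_distrib, expect_sub_distrib, ← mul_expect,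
    expect_prod_one_add_mul_sgn_pow, Fintype.expect_const, h₁, h₂, prod_const_one]
  ring

theorem expect_prod_one_add_mul_sgn_sub_one_pow_four :
    𝔼 x : ι → Bool, (∏ i ∈ T, (1 + μ i * sgn (x i)) - 1) ^ 4
      = ∏ i ∈ T, (1 + (6 * μ i ^ 2 + μ i ^ 4)) - 4 * ∏ i ∈ T, (1 + 3 * μ i ^ 2)
        + 6 * ∏ i ∈ T, (1 + μ i ^ 2) - 3 := by
  have hexpand : ∀ P : ℝ, (P - 1) ^ 4 = P ^ 4 - 4 * P ^ 3 + 6 * P ^ 2 - 4 * P ^ 1 + 1 :=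
    fun P => by ring
  have h₁ : ∀ u : ℝ, ((1 + u) ^ 1 + (1 - u) ^ 1) / 2 = 1 := fun u => by ring
  have h₂ : ∀ u : ℝ, ((1 + u) ^ 2 + (1 - u) ^ 2) / 2 = 1 + u ^ 2 := fun u => by ring
  have h₃ : ∀ u : ℝ, ((1 + u) ^ 3 + (1 - u) ^ 3) / 2 = 1 + 3 * u ^ 2 := fun u => by ring
  have h₄ : ∀ u : ℝ, ((1 + u) ^ 4 + (1 - u) ^ 4) / 2 = 1 + (6 * u ^ 2 + u ^ 4) :=
    fun u => by ring
  simp_rw [hexpand, expect_add_distrib, expect_sub_distrib, expect_add_distrib,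
    expect_sub_distrib, ← mul_expect, expect_prod_one_add_mul_sgn_pow, Fintype.expect_const,
    h₁, h₂, h₃, h₄, prod_const_one]
  ring

theorem expect_prod_one_add_mul_sgn_sub_one_pow_four_le (hle : ∑ i ∈ T, μ i ^ 2 ≤ 1 / 12) :
    𝔼 x : ι → Bool, (∏ i ∈ T, (1 + μ i * sgn (x i)) - 1) ^ 4 ≤ 45 * (∑ i ∈ T, μ i ^ 2) ^ 2 := by
  rw [expect_prod_one_add_mul_sgn_sub_one_pow_four]
  set A := ∑ i ∈ T, μ i ^ 2 with hA
  have hA0 : 0 ≤ A := sum_nonneg fun i _ => sq_nonneg _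
  have hcube : 1 + 3 * A ≤ ∏ i ∈ T, (1 + 3 * μ i ^ 2) := by
    rw [hA, mul_sum]
    exact one_add_sum_le_prod_one_add T fun i _ => by positivity
  have hsquare : ∏ i ∈ T, (1 + μ i ^ 2) ≤ 1 + A + A ^ 2 :=
    (Real.prod_one_add_le_exp_sum T fun i => sq_nonneg (μ i)).trans
      (exp_le_one_add_add_sq hA0 (by linarith))
  have hquartic : ∑ i ∈ T, μ i ^ 4 ≤ A ^ 2 := by
    calc ∑ i ∈ T, μ i ^ 4 = ∑ i ∈ T, (μ i ^ 2) ^ 2 := sum_congr rfl fun i _ => by ring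
      _ ≤ A ^ 2 := sum_sq_le_sq_sum_of_nonneg fun i _ => sq_nonneg _
  have hfourth : ∏ i ∈ T, (1 + (6 * μ i ^ 2 + μ i ^ 4)) ≤ 1 + 6 * A + 39 * A ^ 2 := by
    calc ∏ i ∈ T, (1 + (6 * μ i ^ 2 + μ i ^ 4))
        ≤ Real.exp (∑ i ∈ T, (6 * μ i ^ 2 + μ i ^ 4)) :=
          Real.prod_one_add_le_exp_sum T fun i => by positivity
      _ ≤ Real.exp (6 * A + A ^ 2) := by
          rw [Real.exp_le_exp, sum_add_distrib, ← mul_sum]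
          linarith
      _ ≤ 1 + (6 * A + A ^ 2) + (6 * A + A ^ 2) ^ 2 :=
          exp_le_one_add_add_sq (by positivity) (by nlinarith)
      _ ≤ 1 + 6 * A + 39 * A ^ 2 := by
          nlinarith [mul_nonneg (sq_nonneg A) (sub_nonneg.2 hle), mul_nonneg hA0 (sq_nonneg A),
            mul_nonneg (mul_nonneg hA0 (sq_nonneg A)) (sub_nonneg.2 hle)]
  linarith

theorem sqrt_sum_sq_div_twenty_le_expect_abs_prod_sub_one (hpos : 0 < ∑ i ∈ T, μ i ^ 2)
    (hle : ∑ i ∈ T, μ i ^ 2 ≤ 1 / 12) :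
    √(∑ i ∈ T, μ i ^ 2) / 20 ≤ 𝔼 x : ι → Bool, |∏ i ∈ T, (1 + μ i * sgn (x i)) - 1| := by
  refine div_twenty_le_expect_abs (Real.sqrt_pos.2 hpos) ?_ ?_
  · rw [Real.sq_sqrt hpos.le, expect_prod_one_add_mul_sgn_sub_one_sq]
    linarith [one_add_sum_le_prod_one_add T fun i _ => sq_nonneg (μ i)]
  · have hpow : √(∑ i ∈ T, μ i ^ 2) ^ 4 = (∑ i ∈ T, μ i ^ 2) ^ 2 := by
      rw [pow_mul _ 2 2, Real.sq_sqrt hpos.le]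
    rw [hpow]
    exact expect_prod_one_add_mul_sgn_sub_one_pow_four_le T μ hle

end FourthMoment

theorem sum_toReal_eq_one {α : Type*} [Fintype α] (p : PMF α) : ∑ x, (p x).toReal = 1 := by
  rw [← ENNReal.toReal_sum fun x _ => p.apply_ne_top x, ← tsum_fintype (L := .unconditional _),
    p.tsum_coe, ENNReal.toReal_one]

section FarFromJuntas

theorem exists_subset_le_sum_le_two_mul {ι : Type*} (S : Finset ι) {w : ι → ℝ} {a : ℝ}
    (ha : 0 < a) (hw : ∀ i ∈ S, w i ≤ a) (hS : a ≤ ∑ i ∈ S, w i) :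
    ∃ T ⊆ S, a ≤ ∑ i ∈ T, w i ∧ ∑ i ∈ T, w i ≤ 2 * a := by
  classical
  induction S using Finset.induction_on with
  | empty => exact absurd hS (by simpa using ha)
  | insert i s hi ih =>
    by_cases h : a ≤ ∑ i ∈ s, w i
    · obtain ⟨T, hT, hsum⟩ := ih (fun j hj => hw j (mem_insert_of_mem hj)) h
      exact ⟨T, hT.trans (subset_insert _ _), hsum⟩
    · refine ⟨_, subset_rfl, hS, ?_⟩
      rw [sum_insert hi]
      linarith [hw i (mem_insert_self i s)]

variable {n : ℕ}

theorem sum_biasedPMF_piecewise (μ : Fin n → Set.Ioo (-1 : ℝ) 1) (T : Finset (Fin n))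
    (x : Cube n) :
    ∑ y, (biasedPMF μ (T.piecewise x y)).toReal = ∏ i ∈ T, (1 + μ i * sgn (x i)) := by
  have hcard : (Fintype.card (Cube n) : ℝ) = ∏ _i : Fin n, 2 := by simp
  have hsplit : ∀ y : Cube n, (biasedPMF μ (T.piecewise x y)).toReal * Fintype.card (Cube n)
      = (∏ i ∈ T, (1 + μ i * sgn (x i))) * ∏ i ∈ Tᶜ, (1 + μ i * sgn (y i)) := fun y => by
    rw [biasedPMF_toReal, hcard, ← prod_mul_distrib, ← prod_mul_prod_compl T]
    congr 1 <;> refine prod_congr rfl fun i hi => ?_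
    · rw [piecewise_eq_of_mem _ _ _ hi, div_mul_cancel₀ _ two_ne_zero]
    · rw [piecewise_eq_of_notMem _ _ _ (mem_compl.1 hi), div_mul_cancel₀ _ two_ne_zero]
  have hmarginal : 𝔼 y : Cube n, ∏ i ∈ Tᶜ, (1 + (μ i : ℝ) * sgn (y i)) = 1 := by
    have h := expect_prod_one_add_mul_sgn_pow Tᶜ (fun i => (μ i : ℝ)) 1
    simp only [pow_one] at h
    rw [h]
    exact prod_eq_one fun i _ => by ring
  calc ∑ y, (biasedPMF μ (T.piecewise x y)).toReal
      = 𝔼 y, (biasedPMF μ (T.piecewise x y)).toReal * Fintype.card (Cube n) := by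
        rw [← expect_mul, mul_comm, Fintype.card_mul_expect]
    _ = ∏ i ∈ T, (1 + μ i * sgn (x i)) := by
        simp_rw [hsplit]
        rw [← mul_expect, hmarginal, mul_one]

/-- Averaging both distributions over the coordinates outside `T` cannot increase their `L¹`
distance; it makes `q` uniform. -/
theorem expect_abs_prod_sub_one_le_two_mul_dTV (μ : Fin n → Set.Ioo (-1 : ℝ) 1)
    (T : Finset (Fin n)) {q : PMF (Cube n)}
    (hq : DependsOn (fun x => q x) ((T : Set (Fin n))ᶜ)) :
    𝔼 x : Cube n, |∏ i ∈ T, (1 + μ i * sgn (x i)) - 1| ≤ 2 * dTV (biasedPMF μ) q := by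
  have hq_eq : ∀ x y, q (T.piecewise x y) = q y := fun x y =>
    hq fun i hi => piecewise_eq_of_notMem _ _ _ hi
  calc 𝔼 x : Cube n, |∏ i ∈ T, (1 + μ i * sgn (x i)) - 1|
      = 𝔼 x, |∑ y, ((biasedPMF μ (T.piecewise x y)).toReal
          - (q (T.piecewise x y)).toReal)| := by
        simp_rw [sum_sub_distrib, sum_biasedPMF_piecewise, hq_eq, sum_toReal_eq_one]
    _ ≤ 𝔼 x, ∑ y, |(biasedPMF μ (T.piecewise x y)).toReal - (q (T.piecewise x y)).toReal| :=
        expect_le_expect fun x _ => abs_sum_le_sum_abs _ _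
    _ = ∑ x, |(biasedPMF μ x).toReal - (q x).toReal| :=
        expect_sum_piecewise T fun x => |(biasedPMF μ x).toReal - (q x).toReal|
    _ = 2 * dTV (biasedPMF μ) q := by rw [dTV, mul_div_cancel₀ _ two_ne_zero]

theorem isFarFromJunta_biasedPMF {k : ℕ} {ε : ℝ} (hε : 0 < ε) (hε' : ε ≤ 1 / 200)
    {μ : Fin n → Set.Ioo (-1 : ℝ) 1} (hmax : ∀ i, (μ i : ℝ) ^ 2 ≤ 1600 * ε ^ 2)
    (hsum : ∀ J : Finset (Fin n), #J ≤ k → 1600 * ε ^ 2 ≤ ∑ i ∈ Jᶜ, (μ i : ℝ) ^ 2) :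
    IsFarFromJunta k ε (biasedPMF μ) := by
  rintro q ⟨J, hJ, hdep⟩
  obtain ⟨T, hTJ, hT, hT'⟩ := exists_subset_le_sum_le_two_mul Jᶜ (by positivity)
    (fun i _ => hmax i) (hsum J hJ)
  have hqT : DependsOn (fun x => q x) ((T : Set (Fin n))ᶜ) := fun x y hxy =>
    hdep fun i hi => hxy i fun hiT => mem_compl.1 (hTJ hiT) hi
  have hmoment := sqrt_sum_sq_div_twenty_le_expect_abs_prod_sub_one T (fun i => (μ i : ℝ))
    (lt_of_lt_of_le (by positivity) hT) (by nlinarith)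
  have hdist := expect_abs_prod_sub_one_le_two_mul_dTV μ T hqT
  have hsqrt : 40 * ε ≤ √(∑ i ∈ T, (μ i : ℝ) ^ 2) := Real.le_sqrt_of_sq_le (by linarith)
  linarith

end FarFromJuntas

section ChiSquare

theorem apply_toReal_pos {α : Type*} {p : PMF α} {x : α} (hx : p x ≠ 0) : 0 < (p x).toReal :=
  ENNReal.toReal_pos hx (p.apply_ne_top x)

variable {α β ι κ : Type*} [Fintype α] [Fintype ι] [DecidableEq ι] [Fintype κ]

/-- The chi-squared divergence of `P` from the reference distribution `Q`, which is meant to have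
full support: a point with `Q x = 0` contributes nothing. -/
noncomputable def chiSqDiv (P Q : PMF α) : ℝ :=
  ∑ x, ((P x).toReal - (Q x).toReal) ^ 2 / (Q x).toReal

theorem chiSqDiv_nonneg (P Q : PMF α) : 0 ≤ chiSqDiv P Q :=
  sum_nonneg fun _ _ => div_nonneg (sq_nonneg _) ENNReal.toReal_nonneg

theorem chiSqDiv_self (P : PMF α) : chiSqDiv P P = 0 :=
  sum_eq_zero fun _ _ => by rw [sub_self, zero_pow two_ne_zero, zero_div]

theorem one_add_chiSqDiv (P : PMF α) {Q : PMF α} (hQ : ∀ x, Q x ≠ 0) :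
    1 + chiSqDiv P Q = ∑ x, (P x).toReal ^ 2 / (Q x).toReal := by
  have hexpand : ∀ x, ((P x).toReal - (Q x).toReal) ^ 2 / (Q x).toReal
      = (P x).toReal ^ 2 / (Q x).toReal - 2 * (P x).toReal + (Q x).toReal := fun x => by
    have := (apply_toReal_pos (hQ x)).ne'
    field_simp
    ring
  simp_rw [chiSqDiv, hexpand, sum_add_distrib, sum_sub_distrib, ← mul_sum, sum_toReal_eq_one]
  ring

theorem one_add_chiSqDiv_productPMF (P : ι → PMF κ) {Q : ι → PMF κ} (hQ : ∀ i x, Q i x ≠ 0) :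
    1 + chiSqDiv (productPMF P) (productPMF Q) = ∏ i, (1 + chiSqDiv (P i) (Q i)) := by
  rw [one_add_chiSqDiv _ (productPMF_ne_zero hQ)]
  simp_rw [one_add_chiSqDiv _ (hQ _), prod_univ_sum, Fintype.piFinset_univ, productPMF_apply,
    ENNReal.toReal_prod, ← prod_pow, ← prod_div_distrib]

theorem map_apply_toReal [DecidableEq β] (p : PMF α) (G : α → β) (b : β) :
    (p.map G b).toReal = ∑ x with G x = b, (p x).toReal := by
  rw [PMF.map_apply, tsum_fintype, ← ENNReal.toReal_sum fun x _ => p.apply_ne_top x, sum_filter]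
  congr! 3
  exact eq_comm

theorem sq_map_sub_map_le_chiSqDiv (P : PMF α) {Q : PMF α} (hQ : ∀ x, Q x ≠ 0) (G : α → β)
    (b : β) : ((P.map G b).toReal - (Q.map G b).toReal) ^ 2 ≤ chiSqDiv P Q := by
  classical
  have hterm : ∀ x, 0 ≤ ((P x).toReal - (Q x).toReal) ^ 2 / (Q x).toReal := fun x =>
    div_nonneg (sq_nonneg _) ENNReal.toReal_nonneg
  simp only [map_apply_toReal, ← sum_sub_distrib]
  calc (∑ x with G x = b, ((P x).toReal - (Q x).toReal)) ^ 2
      ≤ (∑ x with G x = b, ((P x).toReal - (Q x).toReal) ^ 2 / (Q x).toReal)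
          * ∑ x with G x = b, (Q x).toReal :=
        sum_sq_le_sum_mul_sum_of_sq_le_mul _ (fun x _ => hterm x)
          (fun x _ => ENNReal.toReal_nonneg)
          fun x _ => (div_mul_cancel₀ _ (apply_toReal_pos (hQ x)).ne').ge
    _ ≤ chiSqDiv P Q * 1 := by
        refine mul_le_mul (sum_le_univ_sum_of_nonneg hterm) ?_
          (sum_nonneg fun x _ => ENNReal.toReal_nonneg) (chiSqDiv_nonneg P Q)
        rw [← sum_toReal_eq_one Q]
        exact sum_le_univ_sum_of_nonneg fun x => ENNReal.toReal_nonneg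
    _ = chiSqDiv P Q := mul_one _

theorem map_productPMF_le_add_of_sum_chiSqDiv_le {P Q : ι → PMF κ} (hQ : ∀ i x, Q i x ≠ 0)
    (hsum : ∑ i, chiSqDiv (P i) (Q i) ≤ 1 / 20) (G : (ι → κ) → β) (b : β) :
    ((productPMF Q).map G b).toReal ≤ ((productPMF P).map G b).toReal + 1 / 4 := by
  have hchi : 1 + chiSqDiv (productPMF P) (productPMF Q) ≤ 1 + 1 / 20 + (1 / 20) ^ 2 := by
    calc 1 + chiSqDiv (productPMF P) (productPMF Q)
        = ∏ i, (1 + chiSqDiv (P i) (Q i)) := one_add_chiSqDiv_productPMF P hQ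
      _ ≤ Real.exp (∑ i, chiSqDiv (P i) (Q i)) :=
          Real.prod_one_add_le_exp_sum univ fun i => chiSqDiv_nonneg _ _
      _ ≤ Real.exp (1 / 20) := Real.exp_le_exp.2 hsum
      _ ≤ 1 + 1 / 20 + (1 / 20) ^ 2 := exp_le_one_add_add_sq (by norm_num) (by norm_num)
  have hsq := sq_map_sub_map_le_chiSqDiv (productPMF P) (productPMF_ne_zero hQ) G b
  have habs := abs_le_of_sq_le_sq' (hsq.trans (by linarith : _ ≤ (1 / 4 : ℝ) ^ 2)) (by norm_num)
  linarith [habs.1]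

end ChiSquare

section MomentMatching

variable {ι : Type*} {q : ℕ} {v : ι → Set.Ioo (-1 : ℝ) 1}

/-- The joint distribution of `q` signs that are independent with mean `v j`, given an index `j`
drawn once from `w`: what `q` samples reveal about one coordinate of a random bias. -/
noncomputable def sampleMixture (q : ℕ) (w : PMF ι) (v : ι → Set.Ioo (-1 : ℝ) 1) :
    PMF (Fin q → Bool) :=
  w.bind fun j => biasedPMF fun _ => v j

theorem div_two_pow_le_sampleMixture (w : PMF ι) {j₀ : ι} (hv : (v j₀ : ℝ) = 0)
    (c : Fin q → Bool) : (w j₀).toReal / 2 ^ q ≤ (sampleMixture q w v c).toReal := by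
  calc (w j₀).toReal / 2 ^ q
      = (w j₀ * biasedPMF (fun _ => v j₀) c).toReal := by
        simp [biasedPMF_toReal, hv, div_eq_mul_inv]
    _ ≤ (sampleMixture q w v c).toReal :=
        ENNReal.toReal_mono (PMF.apply_ne_top _ c) (ENNReal.le_tsum j₀)

theorem sampleMixture_ne_zero {w : PMF ι} {j₀ : ι} (hw : w j₀ ≠ 0) (hv : (v j₀ : ℝ) = 0)
    (c : Fin q → Bool) : sampleMixture q w v c ≠ 0 := fun hc => by
  have hpos : 0 < (w j₀).toReal / 2 ^ q := div_pos (apply_toReal_pos hw) (by positivity)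
  have hle := div_two_pow_le_sampleMixture w hv c
  rw [hc, ENNReal.toReal_zero] at hle
  exact hpos.not_ge hle

variable [Fintype ι]

/-- The `m`-th moment of the node `v j` at a random index `j`. -/
noncomputable def moment (w : PMF ι) (v : ι → ℝ) (m : ℕ) : ℝ := ∑ j, (w j).toReal * v j ^ m

theorem moment_const_mul (w : PMF ι) (a : ℝ) (v : ι → ℝ) (m : ℕ) :
    moment w (fun j => a * v j) m = a ^ m * moment w v m := by
  simp only [moment, mul_pow, mul_sum, mul_left_comm]

theorem abs_moment_le (w : PMF ι) {v : ι → ℝ} {D : ℝ} (hv : ∀ j, |v j| ≤ D) (m : ℕ) :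
    |moment w v m| ≤ D ^ m := by
  calc |moment w v m| ≤ ∑ j, |(w j).toReal * v j ^ m| := abs_sum_le_sum_abs _ _
    _ ≤ ∑ j, (w j).toReal * D ^ m := sum_le_sum fun j _ => by
        rw [abs_mul, abs_of_nonneg ENNReal.toReal_nonneg, abs_pow]
        exact mul_le_mul_of_nonneg_left (pow_le_pow_left₀ (abs_nonneg _) (hv j) m)
          ENNReal.toReal_nonneg
    _ = D ^ m := by rw [← sum_mul, sum_toReal_eq_one, one_mul]

theorem bind_apply_toReal {κ : Type*} (w : PMF ι) (K : ι → PMF κ) (x : κ) :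
    (w.bind K x).toReal = ∑ j, (w j).toReal * (K j x).toReal := by
  rw [PMF.bind_apply, tsum_fintype, ENNReal.toReal_sum fun j _ =>
    ENNReal.mul_ne_top (w.apply_ne_top j) ((K j).apply_ne_top x)]
  simp only [ENNReal.toReal_mul]

theorem sum_biasedPMF_mul_biasedPMF (a b : Set.Ioo (-1 : ℝ) 1) :
    ∑ c, (biasedPMF (fun _ : Fin q => a) c).toReal * (biasedPMF (fun _ => b) c).toReal
      = ((1 + a * b) / 2) ^ q := by
  simp_rw [biasedPMF_toReal, ← prod_mul_distrib]
  rw [← Fintype.piFinset_univ,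
    ← prod_univ_sum (f := fun _ s => (1 + a * sgn s) / 2 * ((1 + b * sgn s) / 2)), prod_const,
    card_univ, Fintype.card_fin, Fintype.sum_bool, sgn_true, sgn_false]
  ring

theorem two_pow_mul_sum_sq_sum_biasedPMF (d : ι → ℝ) (v : ι → Set.Ioo (-1 : ℝ) 1) :
    2 ^ q * ∑ c, (∑ j, d j * (biasedPMF (fun _ : Fin q => v j) c).toReal) ^ 2
      = ∑ m ∈ range (q + 1), q.choose m * (∑ j, d j * (v j : ℝ) ^ m) ^ 2 := by
  calc 2 ^ q * ∑ c, (∑ j, d j * (biasedPMF (fun _ : Fin q => v j) c).toReal) ^ 2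
      = 2 ^ q * ∑ j, ∑ j', d j * d j' * ∑ c, (biasedPMF (fun _ : Fin q => v j) c).toReal
          * (biasedPMF (fun _ => v j') c).toReal := by
        simp_rw [sq, sum_mul_sum, mul_sum _ _ (d _ * d _)]
        rw [sum_comm]
        simp_rw [sum_comm (s := (univ : Finset (Fin q → Bool))), mul_mul_mul_comm]
    _ = ∑ j, ∑ j', d j * d j' * ((v j : ℝ) * v j' + 1) ^ q := by
        simp_rw [sum_biasedPMF_mul_biasedPMF, mul_sum, div_pow]
        refine sum_congr rfl fun j _ => sum_congr rfl fun j' _ => ?_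
        rw [add_comm 1]
        field_simp
    _ = ∑ m ∈ range (q + 1), q.choose m * (∑ j, d j * (v j : ℝ) ^ m) ^ 2 := by
        simp_rw [sq, sum_mul_sum, mul_sum, add_pow, one_pow, mul_one, mul_sum]
        simp_rw [sum_comm (t := range (q + 1))]
        refine sum_congr rfl fun m _ => sum_congr rfl fun j _ => sum_congr rfl fun j' _ => ?_
        ring

theorem two_pow_mul_sum_sq_sampleMixture_sub (w₀ w₁ : PMF ι) (v : ι → Set.Ioo (-1 : ℝ) 1) :
    2 ^ q * ∑ c, ((sampleMixture q w₁ v c).toReal - (sampleMixture q w₀ v c).toReal) ^ 2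
      = ∑ m ∈ range (q + 1), q.choose m
          * (moment w₁ (fun j => v j) m - moment w₀ (fun j => v j) m) ^ 2 := by
  simp only [sampleMixture, bind_apply_toReal, moment, ← sum_sub_distrib, ← sub_mul]
  exact two_pow_mul_sum_sq_sum_biasedPMF _ v

theorem sum_choose_mul_sq_le {d : ℕ → ℝ} {D : ℝ} {M : ℕ} (hzero : ∀ m < M, d m = 0)
    (hd : ∀ m, |d m| ≤ 2 * D ^ m) (hq : q * D ^ 2 ≤ 1 / 2) :
    ∑ m ∈ range (q + 1), q.choose m * d m ^ 2 ≤ 8 * (q * D ^ 2) ^ M := by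
  have hterm : ∀ m, q.choose m * d m ^ 2
      ≤ if M ≤ m then 4 * (q * D ^ 2) ^ M * (1 / 2) ^ (m - M) else 0 := by
    intro m
    split_ifs with hm
    · calc q.choose m * d m ^ 2 ≤ (q : ℝ) ^ m * (2 * D ^ m) ^ 2 :=
            mul_le_mul (by exact_mod_cast Nat.choose_le_pow q m) (sq_le_sq' (abs_le.1 (hd m)).1
              (abs_le.1 (hd m)).2) (sq_nonneg _) (by positivity)
        _ = 4 * (q * D ^ 2) ^ M * (q * D ^ 2) ^ (m - M) := by
            rw [mul_assoc, ← pow_add, Nat.add_sub_cancel' hm]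
            ring
        _ ≤ 4 * (q * D ^ 2) ^ M * (1 / 2) ^ (m - M) := by gcongr
    · rw [hzero m (not_le.1 hm), zero_pow two_ne_zero, mul_zero]
  have hIco : {m ∈ range (q + 1) | M ≤ m} = Ico M (q + 1) := by
    ext m
    simp only [mem_filter, mem_range, mem_Ico, and_comm]
  calc ∑ m ∈ range (q + 1), q.choose m * d m ^ 2
      ≤ 4 * (q * D ^ 2) ^ M * ∑ m ∈ range (q + 1 - M), (1 / 2) ^ m := by
        refine (sum_le_sum fun m _ => hterm m).trans_eq ?_
        rw [← sum_filter, hIco, sum_Ico_eq_sum_range, mul_sum]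
        simp only [Nat.add_sub_cancel_left]
    _ ≤ 4 * (q * D ^ 2) ^ M * 2 := by
        gcongr
        exact sum_geometric_two_le _
    _ = 8 * (q * D ^ 2) ^ M := by ring

theorem chiSqDiv_sampleMixture_le {w₀ w₁ : PMF ι} {j₀ : ι} (hw : w₀ j₀ ≠ 0)
    (hv₀ : (v j₀ : ℝ) = 0) {D : ℝ} (hv : ∀ j, |(v j : ℝ)| ≤ D) (hq : q * D ^ 2 ≤ 1 / 2) {M : ℕ}
    (hM : ∀ m < M, moment w₀ (fun j => v j) m = moment w₁ (fun j => v j) m) :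
    chiSqDiv (sampleMixture q w₁ v) (sampleMixture q w₀ v)
      ≤ 8 * (q * D ^ 2) ^ M / (w₀ j₀).toReal := by
  have hw' := apply_toReal_pos hw
  calc chiSqDiv (sampleMixture q w₁ v) (sampleMixture q w₀ v)
      ≤ ∑ c, ((sampleMixture q w₁ v c).toReal - (sampleMixture q w₀ v c).toReal) ^ 2
          / ((w₀ j₀).toReal / 2 ^ q) := by
        refine sum_le_sum fun c _ => div_le_div_of_nonneg_left (sq_nonneg _) (by positivity) ?_
        exact div_two_pow_le_sampleMixture w₀ hv₀ c
    _ = (∑ m ∈ range (q + 1), q.choose m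
          * (moment w₁ (fun j => v j) m - moment w₀ (fun j => v j) m) ^ 2) / (w₀ j₀).toReal := by
        rw [← two_pow_mul_sum_sq_sampleMixture_sub, ← sum_div]
        field_simp
    _ ≤ 8 * (q * D ^ 2) ^ M / (w₀ j₀).toReal := by
        refine div_le_div_of_nonneg_right ?_ hw'.le
        refine sum_choose_mul_sq_le (fun m hm => by rw [hM m hm, sub_self]) (fun m => ?_) hq
        calc |moment w₁ (fun j => v j) m - moment w₀ (fun j => v j) m|
            ≤ |moment w₁ (fun j => v j) m| + |moment w₀ (fun j => v j) m| := abs_sub _ _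
          _ ≤ 2 * D ^ m := by linarith [abs_moment_le w₀ hv m, abs_moment_le w₁ hv m]

end MomentMatching

section Averaging

variable {α β : Type*}

theorem le_bind_apply_add_toOuterMeasure (p : PMF α) {f : α → PMF β} {b : β} {r : ENNReal}
    (hr : r ≤ 1) {s : Set α} (h : ∀ a ∈ p.support, a ∉ s → r ≤ f a b) :
    r ≤ p.bind f b + p.toOuterMeasure s := by
  rw [PMF.bind_apply, PMF.toOuterMeasure_apply, ← ENNReal.tsum_add]
  calc r = ∑' a, p a * r := by rw [ENNReal.tsum_mul_right, p.tsum_coe, one_mul]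
    _ ≤ ∑' a, (p a * f a b + s.indicator p a) := ENNReal.tsum_le_tsum fun a => by
        by_cases has : a ∈ s
        · rw [Set.indicator_of_mem has]
          exact le_add_left (mul_le_of_le_one_right' hr)
        · by_cases hap : a ∈ p.support
          · exact le_add_right (by gcongr; exact h a hap has)
          · rw [(p.apply_eq_zero_iff a).2 hap, zero_mul]
            exact zero_le

theorem bind_apply_le_bind_apply_add (p : PMF α) {f g : α → PMF β} {b : β} {r : ENNReal}
    (h : ∀ a ∈ p.support, f a b ≤ g a b + r) : p.bind f b ≤ p.bind g b + r := by
  rw [PMF.bind_apply, PMF.bind_apply]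
  calc ∑' a, p a * f a b ≤ ∑' a, (p a * g a b + p a * r) := ENNReal.tsum_le_tsum fun a => by
        by_cases hap : a ∈ p.support
        · rw [← mul_add]
          gcongr
          exact h a hap
        · rw [(p.apply_eq_zero_iff a).2 hap, zero_mul]
          exact zero_le
    _ = ∑' a, p a * g a b + r := by
        rw [ENNReal.tsum_add, ENNReal.tsum_mul_right, p.tsum_coe, one_mul]

variable {n k q : ℕ} {ε : ℝ} {A : RandAlg n} {P : Set (PMF (Cube n))} {𝒟₀ 𝒟₁ : PMF (PMF (Cube n))}

theorem bind_randAlg_run_le (hA : A.MakesAtMost q)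
    (hrun : ∀ T : DetAlg n, T.queries ≤ q →
      (𝒟₀.bind fun p => T.run p) true ≤ (𝒟₁.bind fun p => T.run p) true + 1 / 4) :
    𝒟₀.bind A.run true ≤ 𝒟₁.bind A.run true + 1 / 4 := by
  have hcomm : ∀ 𝒟 : PMF (PMF (Cube n)), 𝒟.bind A.run = A.bind fun T => 𝒟.bind fun p => T.run p :=
    fun 𝒟 => PMF.bind_comm 𝒟 A fun p T => T.run p
  rw [hcomm, hcomm]
  exact bind_apply_le_bind_apply_add A fun T hT => hrun T (hA T hT)

theorem not_isJuntaTester_of_forall_run_le (h₀ : 𝒟₀.support ⊆ P) (h₁ : 𝒟₁.support ⊆ P)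
    (hjunta : 𝒟₀.toOuterMeasure {p | ¬ IsJunta k p} ≤ 1 / 20)
    (hfar : ∀ p ∈ 𝒟₁.support, IsFarFromJunta k ε p) (hA : A.MakesAtMost q)
    (hrun : ∀ T : DetAlg n, T.queries ≤ q →
      (𝒟₀.bind fun p => T.run p) true ≤ (𝒟₁.bind fun p => T.run p) true + 1 / 4) :
    ¬ IsJuntaTester P k ε A := by
  intro htest
  have htwo : (2 / 3 : ENNReal) ≤ 1 := ENNReal.div_le_of_le_mul (by norm_num)
  have haccept : 2 / 3 ≤ 𝒟₀.bind A.run true + 1 / 20 :=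
    (le_bind_apply_add_toOuterMeasure 𝒟₀ htwo fun p hp hpk =>
      (htest p (h₀ hp)).1 (not_not.1 hpk)).trans (add_le_add le_rfl hjunta)
  have hreject : 2 / 3 ≤ 𝒟₁.bind A.run false := by
    simpa using le_bind_apply_add_toOuterMeasure 𝒟₁ htwo (s := ∅) fun p hp _ =>
      (htest p (h₁ hp)).2 (hfar p hp)
  have hle := bind_randAlg_run_le hA hrun
  have hsum := sum_toReal_eq_one (𝒟₁.bind A.run)
  rw [Fintype.sum_bool] at hsum
  have hfin := fun (𝒟 : PMF (PMF (Cube n))) b => (𝒟.bind A.run).apply_ne_top b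
  have hacceptR := ENNReal.toReal_mono (ENNReal.add_ne_top.2 ⟨hfin 𝒟₀ true, by norm_num⟩) haccept
  have hrejectR := ENNReal.toReal_mono (hfin 𝒟₁ false) hreject
  have hleR := ENNReal.toReal_mono (ENNReal.add_ne_top.2 ⟨hfin 𝒟₁ true, by norm_num⟩) hle
  rw [ENNReal.toReal_add (hfin _ _) (by norm_num)] at hacceptR hleR
  simp only [ENNReal.toReal_div, ENNReal.toReal_one, ENNReal.toReal_ofNat] at hacceptR hrejectR hleR
  linarith

end Averaging

section RandomProduct

variable {n : ℕ} {ι : Type*} [Fintype ι]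

/-- The product distribution whose bias at coordinate `i` is `v i j` for an index `j` drawn from
`w`, independently for each `i`. -/
noncomputable def randomProduct (w : PMF ι) (v : Fin n → ι → Set.Ioo (-1 : ℝ) 1) :
    PMF (PMF (Cube n)) :=
  (productPMF fun _ : Fin n => w).map fun a => biasedPMF fun i => v i (a i)

theorem mem_support_randomProduct {w : PMF ι} {v : Fin n → ι → Set.Ioo (-1 : ℝ) 1}
    {p : PMF (Cube n)} : p ∈ (randomProduct w v).support ↔
      ∃ a : Fin n → ι, (∀ i, w (a i) ≠ 0) ∧ biasedPMF (fun i => v i (a i)) = p := by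
  simp only [randomProduct, PMF.support_map, Set.mem_image, PMF.mem_support_iff, productPMF_apply,
    ne_eq, prod_eq_zero_iff, mem_univ, true_and, not_exists]

theorem isProduct_of_mem_support_randomProduct {w : PMF ι} {v : Fin n → ι → Set.Ioo (-1 : ℝ) 1}
    {p : PMF (Cube n)} (hp : p ∈ (randomProduct w v).support) : IsProduct p := by
  obtain ⟨a, -, rfl⟩ := mem_support_randomProduct.1 hp
  exact isProduct_productPMF _

theorem DetAlg.exists_randomProduct_bind_run_eq_map {q : ℕ} {T : DetAlg n} (hT : T.queries ≤ q) :
    ∃ H : (Fin n → Fin q → Bool) → Bool, ∀ (w : PMF ι) (v : Fin n → ι → Set.Ioo (-1 : ℝ) 1),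
      (randomProduct w v).bind (fun p => T.run p)
        = (productPMF fun i => sampleMixture q w (v i)).map H := by
  obtain ⟨G, hG⟩ := T.exists_run_productPMF_eq_map q hT
  refine ⟨G ∘ Function.swap, fun w v => ?_⟩
  have hrun : ∀ a : Fin n → ι, T.run (biasedPMF fun i => v i (a i))
      = (productPMF fun i => biasedPMF fun _ : Fin q => v i (a i)).map (G ∘ Function.swap) :=
    fun a => by
      rw [biasedPMF, hG _ fun i b => signPMF_ne_zero _ b, productPMF_comm, PMF.map_comp]
      rfl
  calc (randomProduct w v).bind (fun p => T.run p)
      = (productPMF fun _ => w).bind fun a =>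
          (productPMF fun i => biasedPMF fun _ : Fin q => v i (a i)).map (G ∘ Function.swap) := by
        rw [randomProduct, PMF.bind_map]
        exact congrArg _ (funext hrun)
    _ = (productPMF fun i => sampleMixture q w (v i)).map (G ∘ Function.swap) := by
        rw [← PMF.map_bind, productPMF_bind (fun _ => w) fun i j => biasedPMF fun _ => v i j]
        rfl

theorem randomProduct_bind_run_le {q : ℕ} {T : DetAlg n} (hT : T.queries ≤ q) {w₀ w₁ : PMF ι}
    {v : Fin n → ι → Set.Ioo (-1 : ℝ) 1} (hne : ∀ i c, sampleMixture q w₀ (v i) c ≠ 0)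
    (hsum : ∑ i, chiSqDiv (sampleMixture q w₁ (v i)) (sampleMixture q w₀ (v i)) ≤ 1 / 20) :
    ((randomProduct w₀ v).bind fun p => T.run p) true
      ≤ ((randomProduct w₁ v).bind fun p => T.run p) true + 1 / 4 := by
  obtain ⟨H, hH⟩ := DetAlg.exists_randomProduct_bind_run_eq_map (ι := ι) hT
  rw [hH, hH]
  have hle := map_productPMF_le_add_of_sum_chiSqDiv_le hne hsum H true
  rw [← ENNReal.toReal_le_toReal (PMF.apply_ne_top _ _)
    (ENNReal.add_ne_top.2 ⟨PMF.apply_ne_top _ _, by norm_num⟩),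
    ENNReal.toReal_add (PMF.apply_ne_top _ _) (by norm_num)]
  simpa using hle

end RandomProduct

section Concentration

variable {α ι κ : Type*} [Fintype α] [Fintype ι] [DecidableEq ι] [Fintype κ]

theorem toOuterMeasure_le_ofReal_sum (p : PMF α) {s : Set α} {g : α → ℝ} (hg : ∀ x, 0 ≤ g x)
    (hs : ∀ x ∈ s, 1 ≤ g x) : p.toOuterMeasure s ≤ ENNReal.ofReal (∑ x, (p x).toReal * g x) := by
  rw [PMF.toOuterMeasure_apply_fintype,
    ENNReal.ofReal_sum_of_nonneg fun x _ => mul_nonneg ENNReal.toReal_nonneg (hg x)]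
  refine sum_le_sum fun x _ => Set.indicator_apply_le' (fun hx => ?_) fun _ => zero_le
  rw [ENNReal.ofReal_mul ENNReal.toReal_nonneg, ENNReal.ofReal_toReal (p.apply_ne_top x)]
  exact le_mul_of_one_le_right' (ENNReal.one_le_ofReal.2 (hs x hx))

theorem sum_productPMF_mul_prod (f : ι → PMF κ) (g : ι → κ → ℝ) :
    ∑ a, (productPMF f a).toReal * ∏ i, g i (a i) = ∏ i, ∑ j, (f i j).toReal * g i j := by
  simp_rw [prod_univ_sum, Fintype.piFinset_univ, prod_mul_distrib, productPMF_apply,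
    ENNReal.toReal_prod]

theorem sum_productPMF_mul_half_pow_card [DecidableEq κ] (w : PMF κ) (j : κ) (B : Finset ι) :
    ∑ a, (productPMF (fun _ : ι => w) a).toReal * (1 / 2) ^ #{i ∈ B | a i = j}
      = (1 - (w j).toReal / 2) ^ #B := by
  have hmean : ∀ i, ∑ l, (w l).toReal * (if i ∈ B ∧ l = j then (1 / 2 : ℝ) else 1)
      = if i ∈ B then 1 - (w j).toReal / 2 else 1 := fun i => by
    have hterm : ∀ l, (w l).toReal * (if i ∈ B ∧ l = j then (1 / 2 : ℝ) else 1)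
        = (w l).toReal - if l = j then (if i ∈ B then (w l).toReal / 2 else 0) else 0 := fun l => by
      split_ifs <;> first | tauto | ring
    simp_rw [hterm]
    rw [sum_sub_distrib, sum_toReal_eq_one, sum_ite_eq' univ j, if_pos (mem_univ j)]
    split_ifs <;> ring
  calc ∑ a, (productPMF (fun _ : ι => w) a).toReal * (1 / 2) ^ #{i ∈ B | a i = j}
      = ∑ a, (productPMF (fun _ : ι => w) a).toReal
          * ∏ i, if i ∈ B ∧ a i = j then (1 / 2 : ℝ) else 1 := by
        refine sum_congr rfl fun a _ => ?_
        rw [← prod_filter, prod_const, ← filter_filter, filter_mem_eq_inter, univ_inter]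
    _ = (1 - (w j).toReal / 2) ^ #B := by
        rw [sum_productPMF_mul_prod (fun _ => w)
          fun i l => if i ∈ B ∧ l = j then (1 / 2 : ℝ) else 1]
        simp_rw [hmean, prod_ite_mem, univ_inter, prod_const]

theorem toOuterMeasure_card_le_le_exp_neg [DecidableEq κ] (w : PMF κ) (j : κ) (B : Finset ι) {m : ℕ}
    (hm : 4 * m ≤ #B * (w j).toReal) :
    (productPMF fun _ : ι => w).toOuterMeasure {a | #{i ∈ B | a i = j} ≤ m}
      ≤ ENNReal.ofReal (Real.exp (-m)) := by
  refine (toOuterMeasure_le_ofReal_sum _ (g := fun a => 2 ^ m * (1 / 2) ^ #{i ∈ B | a i = j})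
    (fun a => by positivity) fun a ha => ?_).trans (ENNReal.ofReal_le_ofReal ?_)
  · calc (1 : ℝ) = 2 ^ m * (1 / 2) ^ m := by rw [← mul_pow]; norm_num
      _ ≤ 2 ^ m * (1 / 2) ^ #{i ∈ B | a i = j} := mul_le_mul_of_nonneg_left
          (pow_le_pow_of_le_one (by norm_num) (by norm_num) ha) (by positivity)
  · have hwj : (w j).toReal ≤ 1 := ENNReal.toReal_le_of_le_ofReal zero_le_one
      (by simpa using w.coe_le_one j)
    have hnonneg : 0 ≤ 1 - (w j).toReal / 2 := by linarith
    calc ∑ a, (productPMF (fun _ : ι => w) a).toReal * (2 ^ m * (1 / 2) ^ #{i ∈ B | a i = j})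
        = 2 ^ m * (1 - (w j).toReal / 2) ^ #B := by
          simp_rw [← sum_productPMF_mul_half_pow_card, mul_left_comm _ ((2 : ℝ) ^ m), mul_sum]
      _ ≤ Real.exp 1 ^ m * Real.exp (-((w j).toReal / 2)) ^ #B := by
          gcongr
          · linarith [Real.add_one_le_exp (1 : ℝ)]
          · exact Real.one_sub_le_exp_neg _
      _ = Real.exp (m - #B * (w j).toReal / 2) := by
          rw [← Real.exp_nat_mul, ← Real.exp_nat_mul, ← Real.exp_add]
          ring_nf
      _ ≤ Real.exp (-m) := Real.exp_le_exp.2 (by linarith)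

end Concentration

section ParityBinomial

variable {L : ℕ}

/-- The integers from `-L` to `L`. -/
def centeredNode (L : ℕ) (j : Fin (2 * L + 1)) : ℝ := j - L

/-- The index of the integer zero. -/
def zeroIndex (L : ℕ) : Fin (2 * L + 1) := ⟨L, by omega⟩

theorem centeredNode_zeroIndex (L : ℕ) : centeredNode L (zeroIndex L) = 0 := sub_self _

theorem abs_centeredNode_le (j : Fin (2 * L + 1)) : |centeredNode L j| ≤ L := by
  have hj : (j : ℝ) ≤ 2 * L := by exact_mod_cast Nat.le_of_lt_succ j.isLt
  rw [centeredNode, abs_le]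
  constructor <;> linarith [Nat.cast_nonneg (α := ℝ) (j : ℕ)]

theorem one_le_centeredNode_sq {j : Fin (2 * L + 1)} (hj : j ≠ zeroIndex L) :
    1 ≤ centeredNode L j ^ 2 := by
  have hne : (j : ℤ) - L ≠ 0 := fun h => hj (Fin.ext (by simp only [zeroIndex]; omega))
  have hint : (0 : ℤ) < ((j : ℤ) - L) ^ 2 := by positivity
  rw [centeredNode]
  exact_mod_cast Int.add_one_le_of_lt hint

/-- The weights of the centered binomial distribution on the integers from `-L` to `L`, conditioned
on being even if `b` is true and on being odd if `b` is false. -/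
noncomputable def parityWeight (L : ℕ) (b : Bool) (j : Fin (2 * L + 1)) : ℝ :=
  (1 + sgn b * (-1) ^ (j + L : ℕ)) * ((2 * L).choose j / 4 ^ L)

theorem parityWeight_nonneg (b : Bool) (j : Fin (2 * L + 1)) : 0 ≤ parityWeight L b j := by
  refine mul_nonneg ?_ (by positivity)
  rcases neg_one_pow_eq_or ℝ (j + L : ℕ) with h | h <;> cases b <;> norm_num [h]

-- Up to a factor, this is the `2 * L`-th finite difference of a polynomial of lower degree.
theorem sum_neg_one_pow_mul_choose_mul_centeredNode_pow {m : ℕ} (hm : m < 2 * L) :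
    ∑ j : Fin (2 * L + 1), (-1) ^ (j + L : ℕ) * ((2 * L).choose j : ℝ) * centeredNode L j ^ m
      = 0 := by
  have hdiff := congrFun (fwdDiff_iter_pow_eq_zero_of_lt (R := ℝ) hm) (-L)
  rw [fwdDiff_iter_eq_sum_shift, Finset.sum_range] at hdiff
  refine .trans (.trans (sum_congr rfl fun j _ => ?_) (mul_sum _ _ ((-1 : ℝ) ^ L)).symm)
    (mul_eq_zero_of_right _ hdiff)
  have hsign : (-1 : ℝ) ^ (2 * L - j : ℕ) = (-1) ^ (j : ℕ) := neg_one_pow_congr <| by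
    simp only [Nat.even_sub (Nat.le_of_lt_succ j.isLt), even_two_mul, true_iff]
  simp only [zsmul_eq_mul, nsmul_eq_mul, Int.cast_mul, Int.cast_pow, Int.cast_neg, Int.cast_one,
    Int.cast_natCast, hsign, centeredNode, pow_add]
  ring

theorem sum_parityWeight_mul_centeredNode_pow (b : Bool) {m : ℕ} (hm : m < 2 * L) :
    ∑ j, parityWeight L b j * centeredNode L j ^ m
      = ∑ j : Fin (2 * L + 1), (2 * L).choose j / 4 ^ L * centeredNode L j ^ m := by
  calc ∑ j, parityWeight L b j * centeredNode L j ^ m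
      = ∑ j : Fin (2 * L + 1), (2 * L).choose j / 4 ^ L * centeredNode L j ^ m
        + sgn b / 4 ^ L * ∑ j : Fin (2 * L + 1),
            (-1) ^ (j + L : ℕ) * ((2 * L).choose j : ℝ) * centeredNode L j ^ m := by
        rw [mul_sum, ← sum_add_distrib]
        exact sum_congr rfl fun j _ => by rw [parityWeight]; ring
    _ = _ := by rw [sum_neg_one_pow_mul_choose_mul_centeredNode_pow hm, mul_zero, add_zero]

theorem sum_parityWeight (hL : 0 < L) (b : Bool) : ∑ j, parityWeight L b j = 1 := by
  have hmass := sum_parityWeight_mul_centeredNode_pow b (m := 0) (Nat.mul_pos two_pos hL)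
  simp only [pow_zero, mul_one] at hmass
  rw [hmass, ← sum_div, ← Finset.sum_range fun j => ((2 * L).choose j : ℝ), ← Nat.cast_sum,
    Nat.sum_range_choose, pow_mul, div_eq_one_iff_eq (by positivity)]
  norm_num

/-- The centered binomial distribution on the integers from `-L` to `L`, conditioned on being even
if `b` is true and on being odd if `b` is false; `hL` makes both events possible. -/
noncomputable def parityBinomial (hL : 0 < L) (b : Bool) : PMF (Fin (2 * L + 1)) :=
  PMF.ofFintype (fun j => ENNReal.ofReal (parityWeight L b j)) <| by
    rw [← ENNReal.ofReal_sum_of_nonneg fun j _ => parityWeight_nonneg b j, sum_parityWeight hL,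
      ENNReal.ofReal_one]

theorem parityBinomial_apply (hL : 0 < L) (b : Bool) (j : Fin (2 * L + 1)) :
    parityBinomial hL b j = ENNReal.ofReal (parityWeight L b j) := rfl

theorem parityBinomial_toReal (hL : 0 < L) (b : Bool) (j : Fin (2 * L + 1)) :
    (parityBinomial hL b j).toReal = parityWeight L b j :=
  ENNReal.toReal_ofReal (parityWeight_nonneg b j)

theorem moment_parityBinomial_congr (hL : 0 < L) (b b' : Bool) {m : ℕ} (hm : m < 2 * L) :
    moment (parityBinomial hL b) (centeredNode L) m
      = moment (parityBinomial hL b') (centeredNode L) m := by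
  simp only [moment, parityBinomial_toReal, sum_parityWeight_mul_centeredNode_pow _ hm]

theorem inv_le_parityBinomial_true_zeroIndex (hL : 0 < L) :
    (L : ℝ)⁻¹ ≤ (parityBinomial hL true (zeroIndex L)).toReal := by
  have hcentral : (4 : ℝ) ^ L ≤ 2 * L * (2 * L).choose L := by
    rw [← Nat.centralBinom_eq_two_mul_choose]
    exact_mod_cast Nat.four_pow_le_two_mul_self_mul_centralBinom L hL
  rw [parityBinomial_toReal, parityWeight, zeroIndex, (Even.neg_one_pow ⟨L, rfl⟩), sgn_true]
  field_simp
  linarith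

theorem parityBinomial_false_zeroIndex (hL : 0 < L) :
    parityBinomial hL false (zeroIndex L) = 0 := by
  rw [parityBinomial_apply, parityWeight, zeroIndex, (Even.neg_one_pow ⟨L, rfl⟩), sgn_false]
  norm_num

end ParityBinomial

section PlantedBias

variable {n k q : ℕ} {ε : ℝ} {ι : Type*}

/-- The biases `v j` of the coordinates in `B`; the other coordinates all receive `v j₀`, which is
zero in the application. -/
def plantedBias (B : Finset (Fin n)) (v : ι → Set.Ioo (-1 : ℝ) 1) (j₀ : ι) (i : Fin n) (j : ι) :
    Set.Ioo (-1 : ℝ) 1 :=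
  v (if i ∈ B then j else j₀)

variable {B : Finset (Fin n)} {v : ι → Set.Ioo (-1 : ℝ) 1} {j₀ : ι}

theorem isJunta_plantedBias [DecidableEq ι] (hv₀ : (v j₀ : ℝ) = 0) {a : Fin n → ι}
    (ha : #{i ∈ B | a i ≠ j₀} ≤ k) : IsJunta k (biasedPMF fun i => plantedBias B v j₀ i (a i)) := by
  refine isJunta_biasedPMF ((card_le_card fun i hi => ?_).trans ha)
  have hbias : (plantedBias B v j₀ i (a i) : ℝ) ≠ 0 := (mem_filter.1 hi).2
  rw [mem_filter]
  by_contra! hB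
  refine hbias ?_
  rw [plantedBias]
  split_ifs with hi
  · rwa [hB hi]
  · exact hv₀

theorem isFarFromJunta_plantedBias (hε : 0 < ε) (hε' : ε ≤ 1 / 200)
    (hmax : ∀ j, (v j : ℝ) ^ 2 ≤ 1600 * ε ^ 2) {δ : ℝ} {a : Fin n → ι}
    (ha : ∀ i, δ ^ 2 ≤ (v (a i) : ℝ) ^ 2) (hδ : 1600 * ε ^ 2 ≤ (#B - k : ℝ) * δ ^ 2) :
    IsFarFromJunta k ε (biasedPMF fun i => plantedBias B v j₀ i (a i)) := by
  refine isFarFromJunta_biasedPMF hε hε' (fun i => hmax _) fun J hJ => ?_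
  have hcard : (#B - k : ℝ) ≤ #(B \ J) := by
    rw [sub_le_iff_le_add]
    exact_mod_cast (tsub_le_iff_right.1 (le_card_sdiff J B)).trans (Nat.add_le_add_left hJ _)
  calc 1600 * ε ^ 2 ≤ (#B - k : ℝ) * δ ^ 2 := hδ
    _ ≤ #(B \ J) * δ ^ 2 := by gcongr
    _ = ∑ i ∈ B \ J, δ ^ 2 := by rw [sum_const, nsmul_eq_mul]
    _ ≤ ∑ i ∈ B \ J, (plantedBias B v j₀ i (a i) : ℝ) ^ 2 := sum_le_sum fun i hi => by
        rw [plantedBias, if_pos (mem_sdiff.1 hi).1]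
        exact ha i
    _ ≤ ∑ i ∈ Jᶜ, (plantedBias B v j₀ i (a i) : ℝ) ^ 2 :=
        sum_le_sum_of_subset_of_nonneg (fun i hi => mem_compl.2 (mem_sdiff.1 hi).2)
          fun i _ _ => sq_nonneg _

theorem sampleMixture_plantedBias (w : PMF ι) (i : Fin n) :
    sampleMixture q w (plantedBias B v j₀ i)
      = if i ∈ B then sampleMixture q w v else biasedPMF fun _ => v j₀ := by
  by_cases hi : i ∈ B
  · simp only [sampleMixture, plantedBias, if_pos hi]
  · simp only [sampleMixture, plantedBias, if_neg hi, PMF.bind_const]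

theorem sum_chiSqDiv_sampleMixture_plantedBias (w₀ w₁ : PMF ι) :
    ∑ i, chiSqDiv (sampleMixture q w₁ (plantedBias B v j₀ i))
        (sampleMixture q w₀ (plantedBias B v j₀ i))
      = #B * chiSqDiv (sampleMixture q w₁ v) (sampleMixture q w₀ v) := by
  have hterm : ∀ i, chiSqDiv (sampleMixture q w₁ (plantedBias B v j₀ i))
      (sampleMixture q w₀ (plantedBias B v j₀ i))
      = if i ∈ B then chiSqDiv (sampleMixture q w₁ v) (sampleMixture q w₀ v) else 0 := fun i => by
    rw [sampleMixture_plantedBias, sampleMixture_plantedBias]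
    split_ifs
    · rfl
    · exact chiSqDiv_self _
  simp_rw [hterm]
  rw [sum_ite_mem, univ_inter, sum_const, nsmul_eq_mul]

theorem not_isJuntaTester_of_moment_eq [Fintype ι] [DecidableEq ι] {w₀ w₁ : PMF ι} {M : ℕ}
    (hw₀ : w₀ j₀ ≠ 0) (hv₀ : (v j₀ : ℝ) = 0)
    (hM : ∀ m < M, moment w₀ (fun j => v j) m = moment w₁ (fun j => v j) m)
    {D δ : ℝ} (hD : ∀ j, |(v j : ℝ)| ≤ D) (hδ : ∀ j, w₁ j ≠ 0 → δ ^ 2 ≤ (v j : ℝ) ^ 2)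
    (hε : 0 < ε) (hε' : ε ≤ 1 / 200) (hmax : D ^ 2 ≤ 1600 * ε ^ 2)
    (hmin : 1600 * ε ^ 2 ≤ (#B - k : ℝ) * δ ^ 2) (hq : q * D ^ 2 ≤ 1 / 2)
    (hB : #B * (8 * (q * D ^ 2) ^ M / (w₀ j₀).toReal) ≤ 1 / 20)
    (hjunta : (productPMF fun _ : Fin n => w₀).toOuterMeasure {a | k < #{i ∈ B | a i ≠ j₀}}
      ≤ 1 / 20) {A : RandAlg n} (hA : A.MakesAtMost q) :
    ¬ IsJuntaTester {p | IsProduct p} k ε A := by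
  refine not_isJuntaTester_of_forall_run_le
    (𝒟₀ := randomProduct w₀ (plantedBias B v j₀)) (𝒟₁ := randomProduct w₁ (plantedBias B v j₀))
    (fun _ => isProduct_of_mem_support_randomProduct)
    (fun _ => isProduct_of_mem_support_randomProduct) ?_ (fun p hp => ?_) hA fun T hT =>
    randomProduct_bind_run_le hT (fun i => sampleMixture_ne_zero hw₀ ?_) ?_
  · rw [randomProduct, PMF.toOuterMeasure_map_apply]
    refine (MeasureTheory.measure_mono fun a (ha : ¬ IsJunta k _) => ?_).trans hjunta
    exact not_le.1 fun hle => ha (isJunta_plantedBias hv₀ hle)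
  · obtain ⟨a, ha, rfl⟩ := mem_support_randomProduct.1 hp
    refine isFarFromJunta_plantedBias hε hε' (fun j => ?_) (fun i => hδ _ (ha i)) hmin
    exact (sq_le_sq' (abs_le.1 (hD j)).1 (abs_le.1 (hD j)).2).trans hmax
  · rwa [plantedBias, ite_self]
  · rw [sum_chiSqDiv_sampleMixture_plantedBias]
    exact (mul_le_mul_of_nonneg_left (chiSqDiv_sampleMixture_le hw₀ hv₀ hD hq hM)
      (Nat.cast_nonneg _)).trans hB

theorem not_isJuntaTester_of_parityBinomial {L : ℕ} (hL : 0 < L) {δ : ℝ} (hε : 0 < ε)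
    (hε' : ε ≤ 1 / 200) (hmax : (L * δ) ^ 2 ≤ 1600 * ε ^ 2)
    (hmin : 1600 * ε ^ 2 ≤ (#B - k : ℝ) * δ ^ 2) (hq : q * (L * δ) ^ 2 ≤ 1 / 2)
    (hB : #B * (8 * (q * (L * δ) ^ 2) ^ (2 * L) * L) ≤ 1 / 20)
    (hjunta : (productPMF fun _ : Fin n => parityBinomial hL true).toOuterMeasure
      {a | k < #{i ∈ B | a i ≠ zeroIndex L}} ≤ 1 / 20) {A : RandAlg n} (hA : A.MakesAtMost q) :
    ¬ IsJuntaTester {p | IsProduct p} k ε A := by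
  have hL' : (0 : ℝ) < L := Nat.cast_pos.2 hL
  have hzero := inv_le_parityBinomial_true_zeroIndex hL
  have hzero_pos := (inv_pos.2 hL').trans_le hzero
  have hnode : ∀ j, |δ * centeredNode L j| ≤ |L * δ| := fun j => by
    rw [abs_mul, abs_mul, Nat.abs_cast, mul_comm]
    exact mul_le_mul_of_nonneg_right (abs_centeredNode_le j) (abs_nonneg δ)
  have hlt : |L * δ| < 1 := (sq_lt_one_iff_abs_lt_one _).1 (by nlinarith)
  let v : Fin (2 * L + 1) → Set.Ioo (-1 : ℝ) 1 := fun j =>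
    ⟨δ * centeredNode L j, abs_lt.1 ((hnode j).trans_lt hlt)⟩
  rw [← sq_abs] at hq hmax hB
  refine not_isJuntaTester_of_moment_eq (v := v) (j₀ := zeroIndex L) (M := 2 * L)
    (w₀ := parityBinomial hL true) (w₁ := parityBinomial hL false) (δ := δ)
    (fun h => hzero_pos.ne' (by rw [h, ENNReal.toReal_zero])) ?_ (fun m hm => ?_) hnode
    (fun j hj => ?_) hε hε' hmax hmin hq (le_trans ?_ hB) hjunta hA
  · simp only [v, centeredNode_zeroIndex, mul_zero]
  · rw [moment_const_mul, moment_const_mul, moment_parityBinomial_congr hL true false hm]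
  · rw [mul_pow]
    refine le_mul_of_one_le_right (sq_nonneg _) (one_le_centeredNode_sq fun h => hj ?_)
    rw [h, parityBinomial_false_zeroIndex]
  · rw [div_eq_mul_inv]
    gcongr
    exact inv_le_of_inv_le₀ hL' hzero

end PlantedBias

section Regimes

variable {n k q L m : ℕ} {ε : ℝ} {A : RandAlg n}

theorem not_isJuntaTester_of_card_eq_add {B : Finset (Fin n)} (hBm : #B = k + m) (hL : 0 < L)
    (hLm : L ^ 2 ≤ m) (hε : 0 < ε) (hε' : ε ≤ 1 / 200) {β : ℝ}
    (hq : 1600 * L ^ 2 * (q * ε ^ 2) ≤ β * m) (hβ : β ≤ 1 / 2)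
    (hB : #B * (8 * β ^ (2 * L) * L) ≤ 1 / 20)
    (hjunta : (productPMF fun _ : Fin n => parityBinomial hL true).toOuterMeasure
      {a | k < #{i ∈ B | a i ≠ zeroIndex L}} ≤ 1 / 20) (hA : A.MakesAtMost q) :
    ¬ IsJuntaTester {p | IsProduct p} k ε A := by
  have hm : (0 : ℝ) < m := Nat.cast_pos.2 ((pow_pos hL 2).trans_le hLm)
  have hLm' : (L : ℝ) ^ 2 ≤ m := by exact_mod_cast hLm
  have hδ : √(1600 * ε ^ 2 / m) ^ 2 = 1600 * ε ^ 2 / m := Real.sq_sqrt (by positivity)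
  have hscale : (L * √(1600 * ε ^ 2 / m)) ^ 2 = 1600 * ε ^ 2 * (L ^ 2 / m) := by
    rw [mul_pow, hδ]
    ring
  have hqβ : q * (1600 * ε ^ 2 * (L ^ 2 / m)) ≤ β := by
    rw [← mul_div_assoc, ← mul_div_assoc, div_le_iff₀ hm]
    linarith
  refine not_isJuntaTester_of_parityBinomial (B := B) hL (δ := √(1600 * ε ^ 2 / m)) hε hε' ?_ ?_ ?_
    ?_ hjunta hA
  · rw [hscale]
    exact mul_le_of_le_one_right (by positivity) ((div_le_one hm).2 hLm')
  · rw [hδ, hBm, Nat.cast_add, add_sub_cancel_left, mul_div_cancel₀ _ hm.ne']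
  · rw [hscale]
    exact hqβ.trans hβ
  · rw [hscale]
    refine le_trans ?_ hB
    gcongr

theorem eq_zeroIndex_of_parityBinomial_one_ne_zero {j : Fin (2 * 1 + 1)}
    (hj : parityBinomial one_pos true j ≠ 0) : j = zeroIndex 1 := by
  contrapose! hj
  rw [parityBinomial_apply, parityWeight]
  fin_cases j
  · norm_num [sgn]
  · exact absurd rfl hj
  · norm_num [sgn]

/-- Each coordinate is unbiased or has a random bias `± δ`, as for testing uniformity. -/
theorem not_isJuntaTester_of_le_sqrt (hε : 0 < ε) (hε' : ε ≤ 1 / 200) (hn : 0 < n)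
    (hk : 2 * k ≤ n) (hq : q * ε ^ 2 ≤ √n / 41600) (hA : A.MakesAtMost q) :
    ¬ IsJuntaTester {p | IsProduct p} k ε A := by
  have hn' : (0 : ℝ) < n := Nat.cast_pos.2 hn
  have hn₁ : (1 : ℝ) ≤ n := by exact_mod_cast hn
  have hs : (1 : ℝ) ≤ √n := Real.one_le_sqrt.2 hn₁
  have hsq : √(n : ℝ) ^ 2 = n := Real.sq_sqrt hn'.le
  have hm : (n : ℝ) / 2 ≤ (n - k : ℕ) := by
    rw [div_le_iff₀ two_pos]
    exact_mod_cast (by omega : n ≤ (n - k) * 2)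
  have hcard : #(univ : Finset (Fin n)) = k + (n - k) := by rw [card_fin]; omega
  refine not_isJuntaTester_of_card_eq_add (L := 1) (β := 1 / (13 * √n)) hcard one_pos (by omega)
    hε hε' ?_ ?_ ?_ ?_ hA
  · calc 1600 * ((1 : ℕ) : ℝ) ^ 2 * (q * ε ^ 2) ≤ √n / 26 := by norm_num; linarith
      _ = 1 / (13 * √n) * (√n ^ 2 / 2) := by field_simp; norm_num
      _ = 1 / (13 * √n) * (n / 2) := by rw [hsq]
      _ ≤ 1 / (13 * √n) * (n - k : ℕ) := by gcongr
  · exact one_div_le_one_div_of_le two_pos (by linarith)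
  · calc (#(univ : Finset (Fin n)) : ℝ) * (8 * (1 / (13 * √n)) ^ (2 * 1) * (1 : ℕ))
        = 8 / 169 * (n / √n ^ 2) := by rw [card_fin, Nat.cast_one, mul_one]; ring
      _ ≤ 1 / 20 := by rw [hsq, div_self hn'.ne']; norm_num
  · refine ((PMF.toOuterMeasure_apply_eq_zero_iff _ _).2 ?_).le.trans zero_le
    refine Set.disjoint_left.2 fun a ha hak => hak.ne_bot (card_eq_zero.2 ?_)
    refine filter_eq_empty_iff.2 fun i _ =>
      not_not.2 (eq_zeroIndex_of_parityBinomial_one_ne_zero ?_)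
    exact prod_ne_zero_iff.1 ((productPMF_apply _ a).symm.trans_ne ha) i (mem_univ i)

theorem toOuterMeasure_lt_card_ne_zeroIndex_le {B : Finset (Fin n)} (hBm : #B = k + m) (hL : 0 < L)
    (hm : 19 ≤ m) (hmk : 4 * L * m ≤ k) :
    (productPMF fun _ : Fin n => parityBinomial hL true).toOuterMeasure
      {a | k < #{i ∈ B | a i ≠ zeroIndex L}} ≤ 1 / 20 := by
  have hmean : 4 * m ≤ #B * (parityBinomial hL true (zeroIndex L)).toReal := by
    calc (4 : ℝ) * m = (4 * L * m) * (L : ℝ)⁻¹ := by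
          rw [mul_right_comm, mul_inv_cancel_right₀ (Nat.cast_pos.2 hL).ne']
      _ ≤ #B * (parityBinomial hL true (zeroIndex L)).toReal := by
          gcongr
          · exact_mod_cast (by omega : 4 * L * m ≤ #B)
          · exact inv_le_parityBinomial_true_zeroIndex hL
  calc (productPMF fun _ : Fin n => parityBinomial hL true).toOuterMeasure
        {a | k < #{i ∈ B | a i ≠ zeroIndex L}}
      ≤ (productPMF fun _ : Fin n => parityBinomial hL true).toOuterMeasure
        {a | #{i ∈ B | a i = zeroIndex L} ≤ m} :=
        MeasureTheory.measure_mono fun a (ha : k < #{i ∈ B | a i ≠ zeroIndex L}) => by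
          have hsplit : #{i ∈ B | a i = zeroIndex L} + #{i ∈ B | a i ≠ zeroIndex L} = k + m :=
            (card_filter_add_card_filter_not _).trans hBm
          exact (by omega : #{i ∈ B | a i = zeroIndex L} ≤ m)
    _ ≤ ENNReal.ofReal (Real.exp (-m)) := toOuterMeasure_card_le_le_exp_neg _ _ _ hmean
    _ ≤ ENNReal.ofReal (1 / 20) := by
        refine ENNReal.ofReal_le_ofReal ?_
        have hm' : (19 : ℝ) ≤ m := by exact_mod_cast hm
        rw [Real.exp_neg, ← one_div]
        exact one_div_le_one_div_of_le (by norm_num) (by linarith [Real.add_one_le_exp (m : ℝ)])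
    _ = 1 / 20 := by rw [ENNReal.ofReal_div_of_pos (by norm_num)]; norm_num

theorem three_twenty_mul_le_two_pow (hL : 16 ≤ L) : 320 * L ≤ 2 ^ L := by
  induction L, hL using Nat.le_induction with
  | base => norm_num
  | succ L hL ih => rw [pow_succ]; omega

theorem eight_mul_cube_le_two_pow (hL : 16 ≤ L) : 8 * L ^ 3 ≤ 2 ^ L := by
  induction L, hL using Nat.le_induction with
  | base => norm_num
  | succ L hL ih =>
    rw [pow_succ 2]
    nlinarith [Nat.mul_le_mul hL (Nat.le_refl (L ^ 2)), Nat.mul_le_mul hL (Nat.le_refl L)]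

theorem exists_le_eight_mul_mul (hL : 16 ≤ L) (hLk : 2 ^ L ≤ 2 * k) :
    ∃ m, L ^ 2 ≤ m ∧ 4 * L * m ≤ k ∧ k ≤ 8 * L * m := by
  have hcube := eight_mul_cube_le_two_pow hL
  have hsq : L ^ 2 ≤ k / (4 * L) := (Nat.le_div_iff_mul_le (by omega)).2 <| by
    linarith [show L ^ 2 * (4 * L) = 4 * L ^ 3 by ring]
  have hlt : k < 4 * L * (k / (4 * L) + 1) := Nat.lt_mul_div_succ k (by omega)
  exact ⟨k / (4 * L), hsq, Nat.mul_div_le k (4 * L), by nlinarith⟩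

theorem not_isJuntaTester_of_le_div_cube (hε : 0 < ε) (hε' : ε ≤ 1 / 200) (hk : 2 * k ≤ n)
    (hL : 16 ≤ L) (hLk : 2 ^ L ≤ 2 * k) (hkL : k < 2 ^ L) (hq : q * ε ^ 2 ≤ k / (25600 * L ^ 3))
    (hA : A.MakesAtMost q) : ¬ IsJuntaTester {p | IsProduct p} k ε A := by
  obtain ⟨m, hLm, hmk, hkm⟩ := exists_le_eight_mul_mul hL hLk
  have hL₀ : 0 < L := by omega
  have hmk' : m ≤ k := (Nat.le_mul_of_pos_left m (by omega)).trans hmk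
  obtain ⟨B, -, hBm⟩ := exists_subset_card_eq (s := (univ : Finset (Fin n))) (n := k + m)
    (by rw [card_fin]; omega)
  refine not_isJuntaTester_of_card_eq_add hBm hL₀ hLm hε hε' (β := 1 / 2) ?_ le_rfl ?_
    (toOuterMeasure_lt_card_ne_zeroIndex_le hBm hL₀ (by nlinarith) hmk) hA
  · have hkm' : (k : ℝ) ≤ 8 * L * m := by exact_mod_cast hkm
    calc 1600 * (L : ℝ) ^ 2 * ((q : ℝ) * ε ^ 2)
        ≤ 1600 * (L : ℝ) ^ 2 * (8 * (L : ℝ) * (m : ℝ) / (25600 * (L : ℝ) ^ 3)) := by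
          gcongr
          exact hq.trans (by gcongr)
      _ = 1 / 2 * (m : ℝ) := by field_simp; ring
  · have hBcard : (#B : ℝ) ≤ 2 * 2 ^ L := by exact_mod_cast (by omega : #B ≤ 2 * 2 ^ L)
    have hL' : (L : ℝ) ≤ 2 ^ L / 320 := by
      rw [le_div_iff₀ (by norm_num), mul_comm]
      exact_mod_cast three_twenty_mul_le_two_pow hL
    calc (#B : ℝ) * (8 * (1 / 2) ^ (2 * L) * L)
        ≤ 2 * 2 ^ L * (8 * (1 / 2) ^ (2 * L) * (2 ^ L / 320)) := by gcongr
      _ = 1 / 20 := by rw [one_div_pow, mul_comm 2 L, pow_mul]; field_simp; norm_num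

theorem add_div_one_add_abs_log_cube_le (hk : 2 ^ 15 ≤ k) {s : ℝ} (hs : 0 ≤ s) (hsk : s ≤ k) :
    (k + s) / (1 + |Real.log (k + s)| ^ 3) ≤ 16 * k / (Nat.log 2 k + 1 : ℕ) ^ 3 := by
  have hl : 15 ≤ Nat.log 2 k := Nat.le_log_of_pow_le (by norm_num) hk
  have hl' : (15 : ℝ) ≤ Nat.log 2 k := by exact_mod_cast hl
  have hpow : (2 : ℝ) ^ Nat.log 2 k ≤ k := by
    exact_mod_cast Nat.pow_log_le_self 2 (by omega : k ≠ 0)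
  have hlog : ((Nat.log 2 k + 1 : ℕ) : ℝ) / 2 ≤ |Real.log (k + s)| := by
    refine le_trans ?_ (le_abs_self _)
    calc ((Nat.log 2 k + 1 : ℕ) : ℝ) / 2 ≤ Nat.log 2 k * Real.log 2 := by
          push_cast
          nlinarith [Real.log_two_gt_d9]
      _ = Real.log (2 ^ Nat.log 2 k) := (Real.log_pow _ _).symm
      _ ≤ Real.log (k + s) := Real.log_le_log (by positivity) (by linarith)
  calc ((k : ℝ) + s) / (1 + |Real.log (k + s)| ^ 3)
      ≤ ((k : ℝ) + k) / (((Nat.log 2 k + 1 : ℕ) : ℝ) / 2) ^ 3 := by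
        gcongr
        exact (pow_le_pow_left₀ (by positivity) hlog 3).trans (le_add_of_nonneg_left zero_le_one)
    _ = 16 * (k : ℝ) / ((Nat.log 2 k + 1 : ℕ) : ℝ) ^ 3 := by field_simp; norm_num

theorem le_queries_of_isJuntaTester_isProduct (hε : 0 < ε) (hε' : ε ≤ 1 / 200) (hn : 2 ^ 30 ≤ n)
    (hk : 2 * k ≤ n) (hA : A.MakesAtMost q) (htest : IsJuntaTester {p | IsProduct p} k ε A) :
    1 / 2000000 * (((k : ℝ) + √n) / (1 + |Real.log (k + √n)| ^ 3)) / ε ^ 2 ≤ q := by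
  by_contra! hlt
  rw [lt_div_iff₀ (by positivity)] at hlt
  rcases le_or_gt (k : ℝ) √n with hkn | hkn
  · refine not_isJuntaTester_of_le_sqrt hε hε' (by omega) hk ?_ hA htest
    have hdenom : ((k : ℝ) + √n) / (1 + |Real.log (k + √n)| ^ 3) ≤ k + √n :=
      div_le_self (by positivity) (le_add_of_nonneg_right (by positivity))
    linarith [Real.sqrt_nonneg (n : ℝ)]
  · have hk' : 2 ^ 15 ≤ k := by
      have hsqrt : (2 : ℝ) ^ 15 ≤ √n := Real.le_sqrt_of_sq_le <| by
        rw [← pow_mul]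
        exact_mod_cast hn
      exact_mod_cast (hsqrt.trans hkn.le : (2 : ℝ) ^ 15 ≤ k)
    have hlog : 15 ≤ Nat.log 2 k := Nat.le_log_of_pow_le (by norm_num) hk'
    have hpow : 2 ^ Nat.log 2 k ≤ k := Nat.pow_log_le_self 2 (by omega)
    refine not_isJuntaTester_of_le_div_cube (L := Nat.log 2 k + 1) hε hε' hk (by omega)
      (by rw [pow_succ]; omega) (Nat.lt_pow_succ_log_self (by norm_num) k) ?_ hA htest
    have hbound := add_div_one_add_abs_log_cube_le hk' (Real.sqrt_nonneg n) hkn.le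
    set l : ℝ := ((Nat.log 2 k + 1 : ℕ) : ℝ)
    calc (q : ℝ) * ε ^ 2 ≤ 1 / 2000000 * (16 * (k : ℝ) / l ^ 3) := hlt.le.trans (by gcongr)
      _ = 16 / 2000000 * ((k : ℝ) / l ^ 3) := by ring
      _ ≤ 1 / 25600 * ((k : ℝ) / l ^ 3) :=
        mul_le_mul_of_nonneg_right (by norm_num) (by positivity)
      _ = (k : ℝ) / (25600 * l ^ 3) := by ring

end Regimes

end JuntaTesting

open JuntaTesting in
theorem theorem6 :
    ∃ (ε₀ : ℝ) (C₀ : ℕ) (c : ℝ) (d : ℕ), 0 < ε₀ ∧ 0 < c ∧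
      ∀ (ε : ℝ) (n k : ℕ), 0 < ε → ε ≤ ε₀ → C₀ ≤ n → (k : ℝ) ≤ (n : ℝ) / 2 →
        ∀ (A : RandAlg n) (q : ℕ), A.MakesAtMost q →
          (IsJuntaTester Set.univ k ε A →
            c * (((k : ℝ) + √(n : ℝ)) / (1 + |Real.log ((k : ℝ) + √(n : ℝ))| ^ d)) / ε ^ 2
              ≤ (q : ℝ)) ∧
          (IsJuntaTester {p | IsProduct p} k ε A →
            c * (((k : ℝ) + √(n : ℝ)) / (1 + |Real.log ((k : ℝ) + √(n : ℝ))| ^ d)) / ε ^ 2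
              ≤ (q : ℝ)) := by
  refine ⟨1 / 200, 2 ^ 30, 1 / 2000000, 3, by norm_num, by norm_num, ?_⟩
  intro ε n k hε hε' hn hk A q hA
  have hk' : 2 * k ≤ n := by
    have : (2 : ℝ) * k ≤ n := by linarith
    exact_mod_cast this
  have hproduct := le_queries_of_isJuntaTester_isProduct hε hε' hn hk' hA
  exact ⟨fun htest => hproduct fun p _ => htest p trivial, hproduct⟩
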